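/- Lie groups are modelled on Hausdorff locally convex spaces over $\mathbb K\in\{\mathbb R,\mathbb C\}$, with smoothness in the Michal--Bastiani sense ($C^k$ maps with continuous iterated directional derivatives). Let $G$ and $N$ be Lie groups, and suppose that the center $Z(N)$ is a split Lie subgroup of $N$: $Z(N)$ is a Lie group, $N_{\rm ad}:=N/Z(N)$ is a manifold, and the inclusion $Z(N)\to N$ and the quotient map $q_N\colon N\to N_{\rm ad}$ are smooth and make $N$ a smooth principal $Z(N)$-bundle over $N_{\rm ad}$. Let $S\colon G\to \operatorname{Aut}(N)$ be a smooth action of $G$ on $N$ by automorphisms (that is, a homomorphism for which $(g,n)\mapsto S(g)(n)$ is smooth), and let $\overline S$ be the induced action on $N_{\rm ad}$. **Notation.** For a Lie group $A$, $C^1_s(G,A)$ is the set of maps $f\colon G\to A$ with $f(1)=1$ that are smooth in a neighborhood of $1$. $C^2_{ss}(G,A)$ is the set of maps $\omega\colon G\times G\to A$ with $\omega(g,1)=\omega(1,g)=1$ that are smooth in a neighborhood of $(1,1)$ and for which, for each $g\in G$, the map $x\mapsto \omega(g,x)\,\omega(gxg^{-1},g)^{-1}$ is smooth in a neighborhood of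 $1$. For an action $T$ of $G$ on $A$ by automorphisms and $f\colon G\to A$, put $(d_Tf)(g,g')=f(g)\,T(g)(f(g'))\,f(gg')^{-1}$. Let $Z^1_s(G,A)_T=\{f\in C^1_s(G,A): d_Tf=1\}$, and let $H^1_s(G,A)_T$ be the pointed set of orbits in $Z^1_s(G,A)_T$ of the action $(n.f)(g)=n f(g)\,T(g)(n)^{-1}$ of $A$, pointed by the class of the constant cocycle $1$. Let $Z^1_s(G,N,Z(N))_S=\{f\in C^1_s(G,N): \operatorname{im}(d_Sf)\subseteq Z(N)\}$. The set $H^1_s(G,Z(N))_S$ is an abelian group, and so is $H^2_{ss}(G,Z(N))_S=Z^2_{ss}(G,Z(N))_S/d_S\big(C^1_s(G,Z(N))\big)$, where $Z^2_{ss}(G,Z(N))_S$ is the group of $2$-cocycles in $C^2_{ss}(G,Z(N))$ with respect to the action $S$ on $Z(N)$. Both groups have their usual structure by pointwise multiplication. A superscript $G$ denotes $G$-fixed points. $\operatorname{Ext}(G,N)$ is the set of equivalence classes of Lie group extensions $1\to N\xrightarrow{\iota}\widehat G\xrightarrow{q} G\to 1$ (short exact sequences of Lie groups for which $\widehat G$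 is a smooth principal $N$-bundle over $G$), where two extensions are equivalent if there is a morphism of Lie groups between them inducing the identity on $N$ and on $G$. A section $\sigma\in C^1_s(G,\widehat G)$ of $q$ has the factor system $(T,\omega)$ if $\sigma(g)\iota(n)\sigma(g)^{-1}=\iota(T(g)(n))$ and $\sigma(g)\sigma(g')\sigma(gg')^{-1}=\iota(\omega(g,g'))$; the extension is then denoted $N\times_{(T,\omega)}G$. $\operatorname{Ext}(G,N)_{[S]}$ is the set of classes of extensions having a factor system $(T,\omega)$ with $T(g)(n)=h(g)\,S(g)(n)\,h(g)^{-1}$ for some $h\in C^1_s(G,N)$. The subset $\operatorname{Ext}(G,N)_{[S],{\rm split}}$ consists of the classes in it of extensions for which $q$ has a section that is a morphism of Lie groups. The group $H^2_{ss}(G,Z(N))_S$ acts on $\operatorname{Ext}(G,N)_{[S]}$ by $[\beta].[N\times_{(S,\omega)}G]=[N\times_{(S,\omega\beta)}G]$. **Statement.** $N_{\rm ad}$ is a Lie group and $\overline S$ is a smooth action on it. There is an exact sequence of groups (for the first four terms), resp. pointed sets, $$Z(N)^G\hookrightarrow N^G\to N_{\rm ad}^G\xrightarrow{\ \delta_0\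 } H^1_s(G,Z(N))_S\to H^1_s(G,N)_S\to H^1_s(G,N_{\rm ad})_{\overline S}\xrightarrow{\ \delta\ }H^2_{ss}(G,Z(N))_S .$$ Here the unlabelled maps are induced by the inclusion $Z(N)\to N$ and by $q_N$, and $\delta_0(q_N(n))$ is the class of $g\mapsto n^{-1}S(g)(n)$. Every $f\in Z^1_s(G,N_{\rm ad})_{\overline S}$ can be written as $f=q_N\circ\widehat f$ with $\widehat f\in Z^1_s(G,N,Z(N))_S$, and $\delta([f])=[d_S\widehat f]$ for each such $\widehat f$. Moreover, in additive notation for $H^2_{ss}(G,Z(N))_S$, $$\operatorname{Ext}(G,N)_{[S],{\rm split}}=-\operatorname{im}(\delta).[N\rtimes_S G].$$ -/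

import Mathlib

open Set Filter Topology
open scoped IsMulCommutative

universe u v w

/-! ## Differential calculus in locally convex spaces -/

/-- A Hausdorff locally convex topological vector space over `𝕜` (`ℝ` or `ℂ`): a topological vector
space whose topology is defined by seminorms. -/
class LCSpace (𝕜 : Type*) (E : Type*) [RCLike 𝕜] [AddCommGroup E] [Module 𝕜 E]
    [TopologicalSpace E] : Prop
    extends IsTopologicalAddGroup E, ContinuousSMul 𝕜 E, PolynormableSpace 𝕜 E, T2Space E

/-- `IsCk 𝕜 k f U`: the map `f` is `C^k` on the open set `U`, in the sense that `f` is continuous,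
the directional derivatives `df (x, h) = lim_{t → 0} t⁻¹ (f (x + t h) - f x)` exist for all `x ∈ U`
and all `h`, and `df` is a `C^{k-1}` map on `U × E` (in particular continuous). -/
def IsCk (𝕜 : Type*) [RCLike 𝕜] {F : Type v} [AddCommGroup F] [Module 𝕜 F] [TopologicalSpace F] :
    ℕ → ∀ {E : Type u} [AddCommGroup E] [Module 𝕜 E] [TopologicalSpace E], (E → F) → Set E → Prop
  | 0, _, _, _, _, f, U => ContinuousOn f U
  | k + 1, E, _, _, _, f, U => ContinuousOn f U ∧ ∃ df : E × E → F,
      (∀ x ∈ U, ∀ h : E,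
        Tendsto (fun t : 𝕜 => t⁻¹ • (f (x + t • h) - f x)) (𝓝[≠] 0) (𝓝 (df (x, h)))) ∧
      IsCk 𝕜 k df (U ×ˢ (univ : Set E))

/-- Smooth (`C^∞`) maps on an open subset of a locally convex space. -/
def IsCInf (𝕜 : Type*) [RCLike 𝕜] {E : Type u} {F : Type v} [AddCommGroup E] [Module 𝕜 E]
    [TopologicalSpace E] [AddCommGroup F] [Module 𝕜 F] [TopologicalSpace F]
    (f : E → F) (U : Set E) : Prop :=
  ∀ k : ℕ, IsCk 𝕜 k f U

section Calculus

variable {𝕜 : Type*} [RCLike 𝕜]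
variable {E : Type u} [AddCommGroup E] [Module 𝕜 E] [TopologicalSpace E]
variable {F : Type v} [AddCommGroup F] [Module 𝕜 F] [TopologicalSpace F]
variable {H : Type w} [AddCommGroup H] [Module 𝕜 H] [TopologicalSpace H]

instance LCSpace.instProd [LCSpace 𝕜 E] [LCSpace 𝕜 F] : LCSpace 𝕜 (E × F) where

theorem IsCk.continuousOn {k : ℕ} {f : E → F} {U : Set E} (h : IsCk 𝕜 k f U) :
    ContinuousOn f U := by
  cases k with
  | zero => exact h
  | succ k => exact h.1

theorem IsCk.mono {k : ℕ} {E : Type u} [AddCommGroup E] [Module 𝕜 E] [TopologicalSpace E]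
    {f : E → F} {U V : Set E} (h : IsCk 𝕜 k f U) (hV : V ⊆ U) : IsCk 𝕜 k f V := by
  induction k generalizing E with
  | zero => exact ContinuousOn.mono h hV
  | succ k ih =>
    obtain ⟨h1, df, h2, h3⟩ := h
    exact ⟨h1.mono hV, df, fun x hx => h2 x (hV hx), ih h3 (prod_mono hV Subset.rfl)⟩

theorem IsCk.of_succ {k : ℕ} {E : Type u} [AddCommGroup E] [Module 𝕜 E] [TopologicalSpace E]
    {f : E → F} {U : Set E} (h : IsCk 𝕜 (k + 1) f U) : IsCk 𝕜 k f U := by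
  induction k generalizing E with
  | zero => exact h.1
  | succ k ih =>
    obtain ⟨h1, df, h2, h3⟩ := h
    exact ⟨h1, df, h2, ih h3⟩

theorem tendsto_line [IsTopologicalAddGroup E] [ContinuousSMul 𝕜 E] (x h : E) :
    Tendsto (fun t : 𝕜 => x + t • h) (𝓝[≠] 0) (𝓝 x) := by
  have : Continuous (fun t : 𝕜 => x + t • h) := by fun_prop
  have h2 := this.tendsto 0
  simp only [zero_smul, add_zero] at h2
  exact h2.mono_left nhdsWithin_le_nhds

theorem IsCk.congr [LCSpace 𝕜 E] {k : ℕ} {f g : E → F} {U : Set E} (h : IsCk 𝕜 k f U)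
    (hU : IsOpen U) (hfg : EqOn g f U) : IsCk 𝕜 k g U := by
  cases k with
  | zero => exact ContinuousOn.congr h hfg
  | succ k =>
    obtain ⟨h1, df, h2, h3⟩ := h
    refine ⟨h1.congr hfg, df, fun x hx y => (h2 x hx y).congr' ?_, h3⟩
    filter_upwards [tendsto_line (𝕜 := 𝕜) x y (hU.mem_nhds hx)] with t ht
    rw [hfg hx, hfg ht]

theorem IsCk.of_local [T2Space F] {k : ℕ} {E : Type u} [AddCommGroup E] [Module 𝕜 E]
    [TopologicalSpace E] [LCSpace 𝕜 E] {f : E → F} {U : Set E} (hU : IsOpen U)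
    (h : ∀ x ∈ U, ∃ V : Set E, IsOpen V ∧ x ∈ V ∧ IsCk 𝕜 k f V) : IsCk 𝕜 k f U := by
  induction k generalizing E with
  | zero =>
    intro x hx
    obtain ⟨V, hV, hxV, hf⟩ := h x hx
    exact (ContinuousOn.continuousAt hf (hV.mem_nhds hxV)).continuousWithinAt
  | succ k ih =>
    have hc : ContinuousOn f U := by
      intro x hx
      obtain ⟨V, hV, hxV, hf⟩ := h x hx
      exact (hf.1.continuousAt (hV.mem_nhds hxV)).continuousWithinAt
    have h' : ∀ x : E, ∃ y : E × E → F, x ∈ U → ∀ h : E,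
        Tendsto (fun t : 𝕜 => t⁻¹ • (f (x + t • h) - f x)) (𝓝[≠] 0) (𝓝 (y (x, h))) := by
      intro x
      by_cases hx : x ∈ U
      · obtain ⟨V, hV, hxV, hf, df, hd, -⟩ := h x hx
        exact ⟨df, fun _ => hd x hxV⟩
      · exact ⟨fun _ => 0, fun h => absurd h hx⟩
    choose d hd using h'
    refine ⟨hc, fun p => d p.1 p, fun x hx y => hd x hx y, ih (hU.prod isOpen_univ) ?_⟩
    rintro ⟨x, y⟩ ⟨hx, -⟩
    obtain ⟨V, hV, hxV, hf, df, hdf, hk⟩ := h x hx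
    have hUV : IsOpen ((U ∩ V) ×ˢ (univ : Set E)) := (hU.inter hV).prod isOpen_univ
    refine ⟨_, hUV, ⟨⟨hx, hxV⟩, trivial⟩,
      (hk.mono (prod_mono inter_subset_right Subset.rfl)).congr hUV ?_⟩
    rintro ⟨a, b⟩ ⟨⟨haU, haV⟩, -⟩
    exact tendsto_nhds_unique (hd a haU b) (hdf a haV b)

theorem IsCk.prodMk {k : ℕ} {E : Type u} [AddCommGroup E] [Module 𝕜 E] [TopologicalSpace E]
    {f : E → F} {g : E → H} {U : Set E} (hf : IsCk 𝕜 k f U) (hg : IsCk 𝕜 k g U) :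
    IsCk 𝕜 k (fun x => (f x, g x)) U := by
  induction k generalizing E with
  | zero => exact ContinuousOn.prodMk hf hg
  | succ k ih =>
    obtain ⟨h1, df, h2, h3⟩ := hf
    obtain ⟨h1', dg, h2', h3'⟩ := hg
    exact ⟨h1.prodMk h1', fun p => (df p, dg p),
      fun x hx y => (h2 x hx y).prodMk_nhds (h2' x hx y), ih h3 h3'⟩

theorem isCk_const [LCSpace 𝕜 F] (k : ℕ) {E : Type u} [AddCommGroup E] [Module 𝕜 E]
    [TopologicalSpace E] (c : F) (U : Set E) : IsCk 𝕜 k (fun _ : E => c) U := by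
  induction k generalizing E c with
  | zero => exact continuousOn_const
  | succ k ih =>
    refine ⟨continuousOn_const, fun _ => 0, fun x _ y => ?_, ih 0 _⟩
    simp

theorem isCk_clm [LCSpace 𝕜 F] (k : ℕ) {E : Type u} [AddCommGroup E] [Module 𝕜 E]
    [TopologicalSpace E] (L : E →L[𝕜] F) (U : Set E) : IsCk 𝕜 k L U := by
  induction k generalizing E with
  | zero => exact L.continuous.continuousOn
  | succ k ih =>
    refine ⟨L.continuous.continuousOn, fun p => L p.2, fun x _ y => ?_,
      ih (L.comp (ContinuousLinearMap.snd 𝕜 E E)) _⟩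
    refine tendsto_const_nhds.congr' ?_
    filter_upwards [self_mem_nhdsWithin] with t ht
    have ht' : t ≠ 0 := ht
    simp [smul_smul, inv_mul_cancel₀ ht']

theorem IsCk.comp_clm {k : ℕ} {E : Type u} [AddCommGroup E] [Module 𝕜 E] [TopologicalSpace E]
    {E' : Type w} [AddCommGroup E'] [Module 𝕜 E'] [TopologicalSpace E'] {f : E → F} {U : Set E}
    (hf : IsCk 𝕜 k f U) (L : E' →L[𝕜] E) {U' : Set E'} (hm : MapsTo L U' U) :
    IsCk 𝕜 k (fun x => f (L x)) U' := by
  induction k generalizing E E' with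
  | zero => exact ContinuousOn.comp hf L.continuous.continuousOn hm
  | succ k ih =>
    obtain ⟨h1, df, h2, h3⟩ := hf
    refine ⟨h1.comp L.continuous.continuousOn hm, fun p => df (L p.1, L p.2), fun x hx y => ?_,
      ih h3 (L.prodMap L) fun p hp => ⟨hm hp.1, trivial⟩⟩
    simpa using h2 (L x) (hm hx) (L y)

theorem exists_dual_of_seminorm {E : Type u} [AddCommGroup E] [Module 𝕜 E]
    (p : Seminorm 𝕜 E) (x : E) :
    ∃ g : E →ₗ[𝕜] 𝕜, g x = (p x : 𝕜) ∧ ∀ y, ‖g y‖ ≤ p y := by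
  let _ : SeminormedAddCommGroup E := p.toSeminormedAddCommGroup
  let _ : NormedSpace 𝕜 E := ⟨fun a b => (map_smul_eq_mul p a b).le⟩
  obtain ⟨g, hg, hgx⟩ := exists_dual_vector'' 𝕜 x
  refine ⟨g, hgx, fun y => ?_⟩
  have h1 := g.le_opNorm y
  have h2 : ‖g‖ * ‖y‖ ≤ 1 * ‖y‖ := mul_le_mul_of_nonneg_right hg (norm_nonneg y)
  rw [one_mul] at h2
  exact h1.trans h2

/-- Directional difference quotients of a `C^1` map along a varying direction. -/
theorem tendsto_quotient_of_tendsto [LCSpace 𝕜 E] [LCSpace 𝕜 F] {g : E → F} {V : Set E}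
    (hV : IsOpen V) {dg : E × E → F}
    (hd : ∀ x ∈ V, ∀ h : E,
      Tendsto (fun t : 𝕜 => t⁻¹ • (g (x + t • h) - g x)) (𝓝[≠] 0) (𝓝 (dg (x, h))))
    (hc : ContinuousOn dg (V ×ˢ (univ : Set E))) {y : E} (hy : y ∈ V) {c : 𝕜 → E} {h : E}
    (hch : Tendsto c (𝓝[≠] 0) (𝓝 h)) :
    Tendsto (fun t : 𝕜 => t⁻¹ • (g (y + t • c t) - g y)) (𝓝[≠] 0) (𝓝 (dg (y, h))) := by
  have hWS := PolynormableSpace.withSeminorms 𝕜 F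
  rw [hWS.tendsto_nhds]
  rintro ⟨p, hp⟩ ε hε
  change ∀ᶠ t in 𝓝[≠] 0, p (t⁻¹ • (g (y + t • c t) - g y) - dg (y, h)) < ε
  have hW : {z : E × E | z.1 ∈ V ∧ p (dg z - dg (y, h)) < ε / 2} ∈ 𝓝 (y, h) := by
    have h1 : ContinuousAt dg (y, h) :=
      hc.continuousAt ((hV.prod isOpen_univ).mem_nhds ⟨hy, trivial⟩)
    have h2 : Tendsto (fun z => p (dg z - dg (y, h))) (𝓝 (y, h)) (𝓝 (p 0)) := by
      refine (hp.tendsto 0).comp ?_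
      have := Tendsto.sub h1 (tendsto_const_nhds (x := dg (y, h)))
      rwa [sub_self] at this
    rw [map_zero] at h2
    filter_upwards [h2.eventually_lt_const (half_pos hε),
      continuous_fst.continuousAt.preimage_mem_nhds (hV.mem_nhds hy)] with z h3 h4
    exact ⟨h4, h3⟩
  have hΦ : Continuous (fun q : (𝕜 × E) × ℝ => (y + ((q.2 : 𝕜) * q.1.1) • q.1.2, q.1.2)) := by
    have := RCLike.continuous_ofReal (K := 𝕜)
    fun_prop
  have hev : ∀ᶠ q : 𝕜 × E in 𝓝 (0, h), ∀ s ∈ Icc (0 : ℝ) 1,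
      (y + ((s : 𝕜) * q.1) • q.2, q.2) ∈ {z : E × E | z.1 ∈ V ∧ p (dg z - dg (y, h)) < ε / 2} := by
    refine isCompact_Icc.eventually_forall_of_forall_eventually fun s _ => ?_
    have := hΦ.tendsto ((0, h), s)
    simp only [mul_zero, zero_smul, add_zero] at this
    exact this hW
  have htc : Tendsto (fun t : 𝕜 => (t, c t)) (𝓝[≠] 0) (𝓝 (0, h)) :=
    (tendsto_id.mono_left nhdsWithin_le_nhds).prodMk_nhds hch
  filter_upwards [htc.eventually hev, self_mem_nhdsWithin] with t ht ht0
  replace ht0 : t ≠ 0 := ht0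
  obtain ⟨G, hG1, hG2⟩ := exists_dual_of_seminorm p (t⁻¹ • (g (y + t • c t) - g y) - dg (y, h))
  have hGc : Continuous G := by
    refine hWS.continuous_normedSpace_rng 𝕜 G ⟨{⟨p, hp⟩}, 1, fun x => ?_⟩
    simpa using hG2 x
  let ψ : ℝ → 𝕜 := fun s => G (t⁻¹ • g (y + ((s : 𝕜) * t) • c t)) - (s : 𝕜) * G (dg (y, h))
  have hψ : ∀ s ∈ Icc (0 : ℝ) 1, HasDerivAt ψ
      (G (dg (y + ((s : 𝕜) * t) • c t, c t)) - G (dg (y, h))) s := by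
    intro s hs
    refine HasDerivAt.sub ?_ ?_
    · rw [hasDerivAt_iff_tendsto_slope_zero]
      have h1 := hd _ (ht s hs).1 (c t)
      have h2 : Tendsto (fun r : ℝ => (r : 𝕜) * t) (𝓝[≠] 0) (𝓝[≠] 0) := by
        refine tendsto_nhdsWithin_iff.2 ⟨?_, ?_⟩
        · have : Continuous (fun r : ℝ => (r : 𝕜) * t) := by
            have := RCLike.continuous_ofReal (K := 𝕜)
            fun_prop
          have h3 := this.tendsto 0
          simp only [RCLike.ofReal_zero, zero_mul] at h3
          exact h3.mono_left nhdsWithin_le_nhds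
        · filter_upwards [self_mem_nhdsWithin] with r hr
          exact mul_ne_zero (RCLike.ofReal_ne_zero.2 hr) ht0
      refine ((hGc.tendsto _).comp (h1.comp h2)).congr' ?_
      filter_upwards [self_mem_nhdsWithin] with r hr
      have hr' : (r : 𝕜) ≠ 0 := RCLike.ofReal_ne_zero.2 hr
      simp only [Function.comp_apply, map_smul, map_sub, smul_eq_mul, RCLike.real_smul_eq_coe_mul,
        RCLike.ofReal_inv, RCLike.ofReal_add, add_mul, add_smul, add_assoc]
      field_simp
    · have h1 : HasDerivAt (fun s : ℝ => (s : 𝕜)) 1 s := by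
        simpa using (RCLike.ofRealCLM (K := 𝕜)).hasDerivAt (x := s)
      simpa using h1.mul_const (G (dg (y, h)))
  have hb : ‖ψ 1 - ψ 0‖ ≤ ε / 2 := by
    refine norm_image_sub_le_of_norm_deriv_le_segment_01'
      (fun s hs => (hψ s hs).hasDerivWithinAt) fun s hs => ?_
    rw [← map_sub]
    exact (hG2 _).trans (ht s (Ico_subset_Icc_self hs)).2.le
  have he : ψ 1 - ψ 0 = G (t⁻¹ • (g (y + t • c t) - g y) - dg (y, h)) := by
    simp only [ψ, RCLike.ofReal_one, RCLike.ofReal_zero, one_mul, zero_mul, zero_smul, add_zero,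
      map_sub, map_smul, smul_sub]
    ring
  rw [he, hG1, RCLike.norm_ofReal, abs_of_nonneg (apply_nonneg p _)] at hb
  linarith

/-- The chain rule: composites of `C^k` maps are `C^k`. -/
theorem IsCk.comp [LCSpace 𝕜 F] [LCSpace 𝕜 H] {k : ℕ} {E : Type u} [AddCommGroup E] [Module 𝕜 E]
    [TopologicalSpace E] [LCSpace 𝕜 E] {f : E → F} {g : F → H} {U : Set E} {V : Set F}
    (hU : IsOpen U) (hV : IsOpen V) (hg : IsCk 𝕜 k g V) (hf : IsCk 𝕜 k f U) (hm : MapsTo f U V) :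
    IsCk 𝕜 k (fun x => g (f x)) U := by
  induction k generalizing E F with
  | zero => exact ContinuousOn.comp hg hf hm
  | succ k ih =>
    have hfk := hf.of_succ
    obtain ⟨h1, df, h2, h3⟩ := hf
    obtain ⟨h1', dg, h2', h3'⟩ := hg
    refine ⟨h1'.comp h1 hm, fun p => dg (f p.1, df p), fun x hx y => ?_, ?_⟩
    · refine (tendsto_quotient_of_tendsto hV h2' h3'.continuousOn (hm hx) (h2 x hx y)).congr' ?_
      filter_upwards [self_mem_nhdsWithin] with t ht
      have ht' : t ≠ 0 := ht
      simp [smul_smul, mul_inv_cancel₀ ht']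
    · have hU' : IsOpen (U ×ˢ (univ : Set E)) := hU.prod isOpen_univ
      have hV' : IsOpen (V ×ˢ (univ : Set F)) := hV.prod isOpen_univ
      have hfst : IsCk 𝕜 k (fun p : E × E => f p.1) (U ×ˢ (univ : Set E)) :=
        hfk.comp_clm (ContinuousLinearMap.fst 𝕜 E E) fun p hp => hp.1
      exact ih hU' hV' h3' (hfst.prodMk h3) fun p hp => ⟨hm hp.1, trivial⟩

end Calculus

/-! ## Manifolds modelled on locally convex spaces -/

/-- A smooth (Hausdorff) manifold over `𝕜` modelled on a Hausdorff locally convex space: the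
coordinate changes of the atlas are smooth. The model space `Model` and the atlas are data. -/
class LCManifold (𝕜 : Type*) [RCLike 𝕜] (M : Type u) [TopologicalSpace M] where
  Model : Type u
  [addCommGroup : AddCommGroup Model]
  [module : Module 𝕜 Model]
  [topologicalSpace : TopologicalSpace Model]
  [lcSpace : LCSpace 𝕜 Model]
  [chartedSpace : ChartedSpace Model M]
  [t2Space : T2Space M]
  compatible : ∀ e ∈ atlas Model M, ∀ e' ∈ atlas Model M,
    IsCInf 𝕜 (fun x => e' (e.symm x)) (e.target ∩ e.symm ⁻¹' e'.source)

attribute [reducible, instance] LCManifold.addCommGroup LCManifold.module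
  LCManifold.topologicalSpace LCManifold.chartedSpace

attribute [instance] LCManifold.lcSpace

/-- `SmoothOn 𝕜 f U`: the set `U` is open, and `f` is a smooth map on `U`, that is, `f` is
continuous on `U` and smooth in all charts. -/
def SmoothOn (𝕜 : Type*) [RCLike 𝕜] {M : Type u} [TopologicalSpace M] [LCManifold 𝕜 M]
    {M' : Type v} [TopologicalSpace M'] [LCManifold 𝕜 M'] (f : M → M') (U : Set M) : Prop :=
  IsOpen U ∧ ContinuousOn f U ∧
    ∀ e ∈ atlas (LCManifold.Model 𝕜 M) M, ∀ e' ∈ atlas (LCManifold.Model 𝕜 M') M',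
      IsCInf 𝕜 (fun x => e' (f (e.symm x))) (e.target ∩ e.symm ⁻¹' (U ∩ f ⁻¹' e'.source))

/-- Smooth maps between manifolds. -/
def Smooth (𝕜 : Type*) [RCLike 𝕜] {M : Type u} [TopologicalSpace M] [LCManifold 𝕜 M]
    {M' : Type v} [TopologicalSpace M'] [LCManifold 𝕜 M'] (f : M → M') : Prop :=
  SmoothOn 𝕜 f univ

/-- `SmoothNear 𝕜 f x`: the map `f` is smooth on some open neighbourhood of `x`. -/
def SmoothNear (𝕜 : Type*) [RCLike 𝕜] {M : Type u} [TopologicalSpace M] [LCManifold 𝕜 M]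
    {M' : Type v} [TopologicalSpace M'] [LCManifold 𝕜 M'] (f : M → M') (x : M) : Prop :=
  ∃ U : Set M, x ∈ U ∧ SmoothOn 𝕜 f U

section Manifold

variable {𝕜 : Type*} [RCLike 𝕜]

theorem chart_isOpen {M : Type*} [TopologicalSpace M] {E : Type*} [TopologicalSpace E]
    {M' : Type*} [TopologicalSpace M'] (e : OpenPartialHomeomorph M E) {f : M → M'} {U : Set M}
    {s : Set M'} (hU : IsOpen U) (hf : ContinuousOn f U) (hs : IsOpen s) :
    IsOpen (e.target ∩ e.symm ⁻¹' (U ∩ f ⁻¹' s)) :=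
  e.isOpen_inter_preimage_symm (hf.isOpen_inter_preimage hU hs)

/-- The product manifold, with the products of charts as charts. -/
instance LCManifold.prod {M : Type u} [TopologicalSpace M] [LCManifold 𝕜 M]
    {M' : Type v} [TopologicalSpace M'] [LCManifold 𝕜 M'] : LCManifold 𝕜 (M × M') where
  Model := LCManifold.Model 𝕜 M × LCManifold.Model 𝕜 M'
  chartedSpace :=
    { atlas := image2 OpenPartialHomeomorph.prod (atlas (LCManifold.Model 𝕜 M) M)
        (atlas (LCManifold.Model 𝕜 M') M')
      chartAt := fun x : M × M' => (chartAt (LCManifold.Model 𝕜 M) x.1).prod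
        (chartAt (LCManifold.Model 𝕜 M') x.2)
      mem_chart_source := fun x : M × M' => ⟨mem_chart_source _ x.1, mem_chart_source _ x.2⟩
      chart_mem_atlas := fun x : M × M' =>
        mem_image2_of_mem (chart_mem_atlas _ x.1) (chart_mem_atlas _ x.2) }
  t2Space := by
    have := LCManifold.t2Space 𝕜 (M := M)
    have := LCManifold.t2Space 𝕜 (M := M')
    infer_instance
  compatible := by
    rintro _ ⟨e₁, h₁, e₂, h₂, rfl⟩ _ ⟨e₁', h₁', e₂', h₂', rfl⟩ k
    let L₁ := ContinuousLinearMap.fst 𝕜 (LCManifold.Model 𝕜 M) (LCManifold.Model 𝕜 M')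
    let L₂ := ContinuousLinearMap.snd 𝕜 (LCManifold.Model 𝕜 M) (LCManifold.Model 𝕜 M')
    exact IsCk.prodMk
      ((LCManifold.compatible e₁ h₁ e₁' h₁' k).comp_clm L₁
        fun (x : LCManifold.Model 𝕜 M × LCManifold.Model 𝕜 M') hx => ⟨hx.1.1, hx.2.1⟩)
      ((LCManifold.compatible e₂ h₂ e₂' h₂' k).comp_clm L₂
        fun (x : LCManifold.Model 𝕜 M × LCManifold.Model 𝕜 M') hx => ⟨hx.1.2, hx.2.2⟩)

variable {M : Type*} [TopologicalSpace M] [LCManifold 𝕜 M]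
variable {M₁ : Type*} [TopologicalSpace M₁] [LCManifold 𝕜 M₁]
variable {M₂ : Type*} [TopologicalSpace M₂] [LCManifold 𝕜 M₂]

theorem SmoothOn.mono {f : M → M₁} {U V : Set M} (hf : SmoothOn 𝕜 f U) (hV : IsOpen V)
    (h : V ⊆ U) : SmoothOn 𝕜 f V :=
  ⟨hV, hf.2.1.mono h, fun e he e' he' k => (hf.2.2 e he e' he' k).mono
    (inter_subset_inter_right _ (preimage_mono (inter_subset_inter_left _ h)))⟩

theorem SmoothOn.congr {f g : M → M₁} {U : Set M} (hf : SmoothOn 𝕜 f U) (h : EqOn g f U) :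
    SmoothOn 𝕜 g U := by
  have hg : ContinuousOn g U := hf.2.1.congr h
  have hs : ∀ s : Set M₁, U ∩ g ⁻¹' s = U ∩ f ⁻¹' s := fun s => by
    ext x
    exact and_congr_right fun hx => by rw [mem_preimage, mem_preimage, h hx]
  refine ⟨hf.1, hg, fun e he e' he' k => ?_⟩
  have ho := chart_isOpen e hf.1 hg e'.open_source
  rw [hs] at ho ⊢
  exact (hf.2.2 e he e' he' k).congr ho fun x hx => congrArg e' (h hx.2.1)

theorem SmoothOn.comp {f : M → M₁} {g : M₁ → M₂} {U : Set M} {V : Set M₁} (hg : SmoothOn 𝕜 g V)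
    (hf : SmoothOn 𝕜 f U) (h : MapsTo f U V) : SmoothOn 𝕜 (fun x => g (f x)) U := by
  have hc : ContinuousOn (fun x => g (f x)) U := hg.2.1.comp hf.2.1 h
  refine ⟨hf.1, hc, fun e he e'' he'' k => ?_⟩
  have hW := chart_isOpen e hf.1 hc e''.open_source
  refine IsCk.of_local hW fun x hx => ?_
  let e' := chartAt (LCManifold.Model 𝕜 M₁) (f (e.symm x))
  have hW' := chart_isOpen e hf.1 hf.2.1 e'.open_source
  have hV' := chart_isOpen e' hg.1 hg.2.1 e''.open_source
  refine ⟨_, hW'.inter hW, ⟨⟨hx.1, hx.2.1, mem_chart_source _ _⟩, hx⟩, ?_⟩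
  refine (IsCk.comp (hW'.inter hW) hV' (hg.2.2 e' (chart_mem_atlas _ _) e'' he'' k)
    ((hf.2.2 e he e' (chart_mem_atlas _ _) k).mono inter_subset_left) ?_).congr
    (hW'.inter hW) ?_
  · rintro z ⟨⟨hz1, hz2, hz3⟩, ⟨-, -, hz4⟩⟩
    refine ⟨e'.map_source hz3, ?_, ?_⟩
    · change e'.symm (e' (f (e.symm z))) ∈ V
      rw [e'.left_inv hz3]
      exact h hz2
    · change g (e'.symm (e' (f (e.symm z)))) ∈ e''.source
      rw [e'.left_inv hz3]
      exact hz4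
  · rintro z ⟨⟨hz1, hz2, hz3⟩, -⟩
    change e'' (g (f (e.symm z))) = e'' (g (e'.symm (e' (f (e.symm z)))))
    rw [e'.left_inv hz3]

theorem smoothOn_of_local {f : M → M₁} {U : Set M} (hU : IsOpen U)
    (h : ∀ x ∈ U, SmoothNear 𝕜 f x) : SmoothOn 𝕜 f U := by
  have hc : ContinuousOn f U := by
    intro x hx
    obtain ⟨V, hxV, hV, hf, -⟩ := h x hx
    exact (hf.continuousAt (hV.mem_nhds hxV)).continuousWithinAt
  refine ⟨hU, hc, fun e he e' he' k => ?_⟩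
  refine IsCk.of_local (chart_isOpen e hU hc e'.open_source) fun x hx => ?_
  obtain ⟨V, hxV, hV, hf, hk⟩ := h _ hx.2.1
  exact ⟨_, chart_isOpen e hV hf e'.open_source, ⟨hx.1, hxV, hx.2.2⟩, hk e he e' he' k⟩

theorem smooth_of_near {f : M → M₁} (h : ∀ x, SmoothNear 𝕜 f x) : Smooth 𝕜 f :=
  smoothOn_of_local isOpen_univ fun x _ => h x

theorem smooth_id : Smooth 𝕜 (fun x : M => x) := by
  refine ⟨isOpen_univ, continuousOn_id, fun e he e' he' k => ?_⟩
  have h := LCManifold.compatible e he e' he' k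
  simpa using h

theorem smooth_const (c : M₁) : Smooth 𝕜 (fun _ : M => c) :=
  ⟨isOpen_univ, continuousOn_const, fun _ _ _ _ k => isCk_const k _ _⟩

theorem smooth_fst : Smooth 𝕜 (fun x : M × M₁ => x.1) := by
  refine ⟨isOpen_univ, continuousOn_fst, ?_⟩
  rintro _ ⟨e₁, h₁, e₂, h₂, rfl⟩ e' he' k
  exact (LCManifold.compatible e₁ h₁ e' he' k).comp_clm (ContinuousLinearMap.fst 𝕜 (LCManifold.Model 𝕜 M) (LCManifold.Model 𝕜 M₁))
    fun (x : LCManifold.Model 𝕜 M × LCManifold.Model 𝕜 M₁) hx => ⟨hx.1.1, hx.2.2⟩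

theorem smooth_snd : Smooth 𝕜 (fun x : M × M₁ => x.2) := by
  refine ⟨isOpen_univ, continuousOn_snd, ?_⟩
  rintro _ ⟨e₁, h₁, e₂, h₂, rfl⟩ e' he' k
  exact (LCManifold.compatible e₂ h₂ e' he' k).comp_clm (ContinuousLinearMap.snd 𝕜 (LCManifold.Model 𝕜 M) (LCManifold.Model 𝕜 M₁))
    fun (x : LCManifold.Model 𝕜 M × LCManifold.Model 𝕜 M₁) hx => ⟨hx.1.2, hx.2.2⟩

theorem SmoothOn.prodMk {f : M → M₁} {g : M → M₂} {U : Set M} (hf : SmoothOn 𝕜 f U)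
    (hg : SmoothOn 𝕜 g U) : SmoothOn 𝕜 (fun x => (f x, g x)) U := by
  refine ⟨hf.1, hf.2.1.prodMk hg.2.1, ?_⟩
  rintro e he _ ⟨e₁, h₁, e₂, h₂, rfl⟩ k
  refine IsCk.prodMk (f := fun x => e₁ (f (e.symm x))) (g := fun x => e₂ (g (e.symm x))) ?_ ?_
  · exact (hf.2.2 e he e₁ h₁ k).mono fun x hx => ⟨hx.1, hx.2.1, hx.2.2.1⟩
  · exact (hg.2.2 e he e₂ h₂ k).mono fun x hx => ⟨hx.1, hx.2.1, hx.2.2.2⟩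

theorem Smooth.on {f : M → M₁} (hf : Smooth 𝕜 f) {U : Set M} (hU : IsOpen U) : SmoothOn 𝕜 f U :=
  SmoothOn.mono hf hU (subset_univ _)

theorem Smooth.comp_on {f : M → M₁} {g : M₁ → M₂} (hg : Smooth 𝕜 g) {U : Set M}
    (hf : SmoothOn 𝕜 f U) : SmoothOn 𝕜 (fun x => g (f x)) U :=
  SmoothOn.comp hg hf fun _ _ => trivial

theorem Smooth.comp {f : M → M₁} {g : M₁ → M₂} (hg : Smooth 𝕜 g) (hf : Smooth 𝕜 f) :
    Smooth 𝕜 (fun x => g (f x)) :=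
  hg.comp_on hf

theorem Smooth.prodMk {f : M → M₁} {g : M → M₂} (hf : Smooth 𝕜 f) (hg : Smooth 𝕜 g) :
    Smooth 𝕜 (fun x => (f x, g x)) :=
  SmoothOn.prodMk hf hg

theorem Smooth.near {f : M → M₁} (hf : Smooth 𝕜 f) (x : M) : SmoothNear 𝕜 f x :=
  ⟨univ, trivial, hf⟩

theorem SmoothNear.prodMk {f : M → M₁} {g : M → M₂} {x : M} (hf : SmoothNear 𝕜 f x)
    (hg : SmoothNear 𝕜 g x) : SmoothNear 𝕜 (fun x => (f x, g x)) x := by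
  obtain ⟨U, hxU, hU⟩ := hf
  obtain ⟨V, hxV, hV⟩ := hg
  exact ⟨U ∩ V, ⟨hxU, hxV⟩, (hU.mono (hU.1.inter hV.1) inter_subset_left).prodMk
    (hV.mono (hU.1.inter hV.1) inter_subset_right)⟩

theorem SmoothNear.comp {f : M → M₁} {g : M₁ → M₂} {x : M} (hg : SmoothNear 𝕜 g (f x))
    (hf : SmoothNear 𝕜 f x) : SmoothNear 𝕜 (fun x => g (f x)) x := by
  obtain ⟨U, hxU, hU⟩ := hf
  obtain ⟨V, hxV, hV⟩ := hg
  have hUV : IsOpen (U ∩ f ⁻¹' V) := hU.2.1.isOpen_inter_preimage hU.1 hV.1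
  exact ⟨U ∩ f ⁻¹' V, ⟨hxU, hxV⟩, hV.comp (hU.mono hUV inter_subset_left) fun y hy => hy.2⟩

theorem Smooth.comp_near {f : M → M₁} {g : M₁ → M₂} (hg : Smooth 𝕜 g) {x : M}
    (hf : SmoothNear 𝕜 f x) : SmoothNear 𝕜 (fun x => g (f x)) x :=
  (hg.near _).comp hf

end Manifold

/-! ## Lie groups, actions, and cochains -/

/-- A Lie group over `𝕜` modelled on a locally convex space: multiplication and inversion are
smooth. -/
class LCLieGroup (𝕜 : Type*) [RCLike 𝕜] (G : Type u) [TopologicalSpace G] [Group G]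
    [LCManifold 𝕜 G] : Prop where
  smooth_mul : Smooth 𝕜 (fun p : G × G => p.1 * p.2)
  smooth_inv : Smooth 𝕜 (fun g : G => g⁻¹)

/-- The sequence `H → P → B` of group homomorphisms between groups that are manifolds is short exact
and makes `P` a smooth principal `H`-bundle over `B` with respect to the right multiplication action
of `H`: both maps are smooth, and over suitable open sets `U ⊆ B` covering `B` there is a smooth
section `σ` such that `(u, h) ↦ σ u * ι h` is a diffeomorphism from `U × H` onto `q ⁻¹' U`, with
inverse `p ↦ (q p, κ p)`. -/
structure IsLieExtension (𝕜 : Type*) [RCLike 𝕜]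
    {H : Type*} [TopologicalSpace H] [Group H] [LCManifold 𝕜 H]
    {P : Type*} [TopologicalSpace P] [Group P] [LCManifold 𝕜 P]
    {B : Type*} [TopologicalSpace B] [Group B] [LCManifold 𝕜 B]
    (ι : H →* P) (q : P →* B) : Prop where
  smooth_ι : Smooth 𝕜 ι
  smooth_q : Smooth 𝕜 q
  injective : Function.Injective ι
  surjective : Function.Surjective q
  exact : q.ker = ι.range
  locally_trivial : ∀ b : B, ∃ U : Set B, b ∈ U ∧ ∃ (σ : B → P) (κ : P → H),
    SmoothOn 𝕜 σ U ∧ (∀ x ∈ U, q (σ x) = x) ∧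
    SmoothOn 𝕜 κ (q ⁻¹' U) ∧ ∀ p, q p ∈ U → p = σ (q p) * ι (κ p)

/-- The normal subgroup `H` of `P` is a split Lie subgroup: for the given Lie group structure on `H`
and the given manifold structure on `P ⧸ H`, the inclusion `H → P` is smooth and `P` is a smooth
principal `H`-bundle over `P ⧸ H` (these structures are then unique). Local triviality forces the
topologies of the Lie group `H` and the manifold `P ⧸ H` to be the subspace and quotient topology,
so these are the topologies that are used here. -/
def IsSplitLieSubgroup (𝕜 : Type*) [RCLike 𝕜] {P : Type*} [TopologicalSpace P] [Group P]
    [LCManifold 𝕜 P] (H : Subgroup P) [H.Normal] [LCManifold 𝕜 H] [LCLieGroup 𝕜 H]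
    [LCManifold 𝕜 (P ⧸ H)] : Prop :=
  IsLieExtension 𝕜 H.subtype (QuotientGroup.mk' H)

section LieGroup

variable {𝕜 : Type*} [RCLike 𝕜]
variable {M : Type*} [TopologicalSpace M] [LCManifold 𝕜 M]
variable {G : Type*} [TopologicalSpace G] [Group G] [LCManifold 𝕜 G] [LCLieGroup 𝕜 G]

theorem SmoothOn.mul {f g : M → G} {U : Set M} (hf : SmoothOn 𝕜 f U) (hg : SmoothOn 𝕜 g U) :
    SmoothOn 𝕜 (fun x => f x * g x) U :=
  (LCLieGroup.smooth_mul (𝕜 := 𝕜) (G := G)).comp_on (hf.prodMk hg)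

theorem SmoothOn.inv {f : M → G} {U : Set M} (hf : SmoothOn 𝕜 f U) :
    SmoothOn 𝕜 (fun x => (f x)⁻¹) U :=
  (LCLieGroup.smooth_inv (𝕜 := 𝕜) (G := G)).comp_on hf

theorem Smooth.mul {f g : M → G} (hf : Smooth 𝕜 f) (hg : Smooth 𝕜 g) :
    Smooth 𝕜 (fun x => f x * g x) :=
  SmoothOn.mul hf hg

theorem Smooth.inv {f : M → G} (hf : Smooth 𝕜 f) : Smooth 𝕜 (fun x => (f x)⁻¹) :=
  SmoothOn.inv hf

theorem SmoothNear.mul {f g : M → G} {x : M} (hf : SmoothNear 𝕜 f x) (hg : SmoothNear 𝕜 g x) :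
    SmoothNear 𝕜 (fun x => f x * g x) x :=
  (LCLieGroup.smooth_mul (𝕜 := 𝕜) (G := G)).comp_near (hf.prodMk hg)

theorem SmoothNear.inv {f : M → G} {x : M} (hf : SmoothNear 𝕜 f x) :
    SmoothNear 𝕜 (fun x => (f x)⁻¹) x :=
  (LCLieGroup.smooth_inv (𝕜 := 𝕜) (G := G)).comp_near hf

end LieGroup

/-- The action of the automorphisms of `N` on the centre of `N`. -/
def centerAut (N : Type*) [Group N] : MulAut N →* MulAut (Subgroup.center N) where
  toFun φ := Subgroup.centerCongr φ
  map_one' := by ext; rfl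
  map_mul' _ _ := by ext; rfl

/-- The action of the automorphisms of `N` on `N_ad = N / Z(N)`. -/
def adAut (N : Type*) [Group N] : MulAut N →* MulAut (N ⧸ Subgroup.center N) where
  toFun φ := QuotientGroup.congr (Subgroup.center N) (Subgroup.center N) φ
    (Subgroup.characteristic_iff_map_eq.1 inferInstance φ)
  map_one' := by
    ext x
    obtain ⟨n, rfl⟩ := QuotientGroup.mk_surjective x
    rfl
  map_mul' _ _ := by
    ext x
    obtain ⟨n, rfl⟩ := QuotientGroup.mk_surjective x
    rfl

/-- The subgroup `A^G` of fixed points of an action of `G` on `A` by automorphisms. -/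
def fixedPts {G A : Type*} [Group G] [Group A] (S : G →* MulAut A) : Subgroup A where
  carrier := {a | ∀ g, S g a = a}
  one_mem' g := map_one (S g)
  mul_mem' ha hb g := by rw [map_mul, ha g, hb g]
  inv_mem' ha g := by rw [map_inv, ha g]

section Cochains

variable (𝕜 : Type*) [RCLike 𝕜]
variable (G : Type*) [TopologicalSpace G] [Group G] [LCManifold 𝕜 G]
variable (A : Type*) [TopologicalSpace A] [Group A] [LCManifold 𝕜 A]

/-- `C^1_s(G, A)`: normalized maps `G → A` that are smooth in an identity neighbourhood. -/
def C1s : Set (G → A) := {f | f 1 = 1 ∧ SmoothNear 𝕜 f 1}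

/-- `C^2_s(G, A)`: normalized maps `G × G → A` that are smooth in an identity neighbourhood. -/
def C2s : Set (G × G → A) :=
  {ω | (∀ g, ω (g, 1) = 1 ∧ ω (1, g) = 1) ∧ SmoothNear 𝕜 ω (1, 1)}

/-- `C^2_ss(G, A)`: those `ω ∈ C^2_s(G, A)` for which all the maps
`ω_g : x ↦ ω(g, x) ω(g x g⁻¹, g)⁻¹` are smooth in an identity neighbourhood. -/
def C2ss : Set (G × G → A) :=
  {ω | ω ∈ C2s 𝕜 G A ∧
    ∀ g, SmoothNear 𝕜 (fun x : G => ω (g, x) * (ω (g * x * g⁻¹, g))⁻¹) 1}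

end Cochains

section Nonabelian

variable {G A : Type*} [Group G] [Group A]

/-- `(d_S f)(g, g') = f(g) S(g)(f(g')) f(g g')⁻¹` for `f : G → A`. -/
def dS (S : G →* MulAut A) (f : G → A) : G × G → A :=
  fun p => f p.1 * S p.1 (f p.2) * (f (p.1 * p.2))⁻¹

variable (𝕜 : Type*) [RCLike 𝕜] [TopologicalSpace G] [LCManifold 𝕜 G]
  [TopologicalSpace A] [LCManifold 𝕜 A]

/-- `Z^1_s(G, A)_S`: the `1`-cocycles (crossed homomorphisms) in `C^1_s(G, A)`. -/
def Z1s (S : G →* MulAut A) : Set (G → A) :=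
  {f | f ∈ C1s 𝕜 G A ∧ ∀ g g', f (g * g') = f g * S g (f g')}

/-- `Z^1_s(G, A, Z(A))_S`: the `f ∈ C^1_s(G, A)` for which `d_S f` is central. -/
def Z1sCentral (S : G →* MulAut A) : Set (G → A) :=
  {f | f ∈ C1s 𝕜 G A ∧ ∀ p, dS S f p ∈ Subgroup.center A}

/-- Two cocycles are cohomologous if they lie in the same orbit of the action
`(n.f)(g) = n f(g) S(g)(n)⁻¹` of `A`. -/
def H1s.setoid (S : G →* MulAut A) : Setoid (Z1s 𝕜 S) where
  r f f' := ∃ n : A, ∀ g, f'.1 g = n * f.1 g * (S g n)⁻¹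
  iseqv :=
    { refl := fun f => ⟨1, fun g => by simp⟩
      symm := by
        rintro f f' ⟨n, hn⟩
        refine ⟨n⁻¹, fun g => ?_⟩
        rw [hn g, map_inv]
        group
      trans := by
        rintro f f' f'' ⟨n, hn⟩ ⟨m, hm⟩
        refine ⟨m * n, fun g => ?_⟩
        rw [hm g, hn g, map_mul]
        group }

/-- The cohomology set `H^1_s(G, A)_S`, the set of `A`-orbits in `Z^1_s(G, A)_S`. -/
def H1s (S : G →* MulAut A) : Type _ := Quotient (H1s.setoid 𝕜 S)

/-- The class of a cocycle in `H^1_s(G, A)_S`. -/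
def H1s.mk (S : G →* MulAut A) (f : Z1s 𝕜 S) : H1s 𝕜 S := Quotient.mk (H1s.setoid 𝕜 S) f

/-- The base point of `H^1_s(G, A)_S`, the class of the constant cocycle `1`. -/
def H1s.base (S : G →* MulAut A) : H1s 𝕜 S :=
  H1s.mk 𝕜 S ⟨fun _ => 1, ⟨rfl, (smooth_const 1).near 1⟩, fun g g' => by simp⟩

end Nonabelian

section CenterCohomology

variable (𝕜 : Type*) [RCLike 𝕜]
variable {G : Type*} [TopologicalSpace G] [Group G] [LCManifold 𝕜 G]
variable {N : Type*} [TopologicalSpace N] [Group N] [LCManifold 𝕜 N] [LCLieGroup 𝕜 N]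

variable (G N) in
/-- `C^1_s(G, Z(N))`: the `Z(N)`-valued elements of `C^1_s(G, N)`. -/
def C1sZ : Subgroup (G → Subgroup.center N) where
  carrier := {f | (fun g => (f g : N)) ∈ C1s 𝕜 G N}
  one_mem' := ⟨rfl, (smooth_const 1).near 1⟩
  mul_mem' := by
    rintro f f' ⟨h1, h2⟩ ⟨h1', h2'⟩
    refine ⟨?_, h2.mul h2'⟩
    change (f 1 : N) * (f' 1 : N) = 1
    rw [show (f 1 : N) = 1 from h1, show (f' 1 : N) = 1 from h1', mul_one]
  inv_mem' := by
    rintro f ⟨h1, h2⟩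
    refine ⟨?_, h2.inv⟩
    change ((f 1 : N))⁻¹ = 1
    rw [show (f 1 : N) = 1 from h1, inv_one]

variable (G N) in
/-- `C^2_ss(G, Z(N))`: the `Z(N)`-valued elements of `C^2_ss(G, N)`. -/
def C2ssZ : Subgroup (G × G → Subgroup.center N) where
  carrier := {ω | (fun p => (ω p : N)) ∈ C2ss 𝕜 G N}
  one_mem' := by
    refine ⟨⟨fun g => ⟨rfl, rfl⟩, (smooth_const 1).near _⟩, fun g => ?_⟩
    have h : SmoothNear 𝕜 (fun _ : G => (1 : N) * 1⁻¹) 1 := (smooth_const _).near 1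
    exact h
  mul_mem' := by
    rintro ω ω' ⟨⟨h1, h2⟩, h3⟩ ⟨⟨h1', h2'⟩, h3'⟩
    refine ⟨⟨fun g => ⟨?_, ?_⟩, h2.mul h2'⟩, fun g => ?_⟩
    · change (ω (g, 1) : N) * (ω' (g, 1) : N) = 1
      rw [show (ω (g, 1) : N) = 1 from (h1 g).1, show (ω' (g, 1) : N) = 1 from (h1' g).1, mul_one]
    · change (ω (1, g) : N) * (ω' (1, g) : N) = 1
      rw [show (ω (1, g) : N) = 1 from (h1 g).2, show (ω' (1, g) : N) = 1 from (h1' g).2, mul_one]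
    · have h : (fun x : G => ((ω * ω') (g, x) : N) * ((ω * ω') (g * x * g⁻¹, g) : N)⁻¹) =
          fun x => ((ω (g, x) : N) * (ω (g * x * g⁻¹, g) : N)⁻¹) *
            ((ω' (g, x) : N) * (ω' (g * x * g⁻¹, g) : N)⁻¹) := by
        funext x
        have hc := Subgroup.mem_center_iff.1 (ω (g * x * g⁻¹, g))⁻¹.2
        have hc' := hc ((ω' (g, x) : N) * (ω' (g * x * g⁻¹, g) : N)⁻¹)
        simp only [Pi.mul_apply, Subgroup.coe_mul, mul_inv_rev, Subgroup.coe_inv] at hc' ⊢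
        simp only [mul_assoc] at hc' ⊢
        rw [hc']
      exact h ▸ (h3 g).mul (h3' g)
  inv_mem' := by
    rintro ω ⟨⟨h1, h2⟩, h3⟩
    refine ⟨⟨fun g => ⟨?_, ?_⟩, h2.inv⟩, fun g => ?_⟩
    · change (ω (g, 1) : N)⁻¹ = 1
      rw [show (ω (g, 1) : N) = 1 from (h1 g).1, inv_one]
    · change (ω (1, g) : N)⁻¹ = 1
      rw [show (ω (1, g) : N) = 1 from (h1 g).2, inv_one]
    · have h : (fun x : G => ((ω⁻¹) (g, x) : N) * ((ω⁻¹) (g * x * g⁻¹, g) : N)⁻¹) =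
          fun x => ((ω (g, x) : N) * (ω (g * x * g⁻¹, g) : N)⁻¹)⁻¹ := by
        funext x
        have hc := Subgroup.mem_center_iff.1 (ω (g * x * g⁻¹, g)).2 (ω (g, x) : N)⁻¹
        simp only [Pi.inv_apply, Subgroup.coe_inv, inv_inv, mul_inv_rev]
        exact hc
      exact h ▸ (h3 g).inv

/-- The differential `d_S : C^0(G, Z(N)) → C^1(G, Z(N))`, written multiplicatively. -/
def d0 (S : G →* MulAut N) : Subgroup.center N →* (G → Subgroup.center N) where
  toFun z g := centerAut N (S g) z / z
  map_one' := by funext g; simp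
  map_mul' z z' := by funext g; simp [mul_div_mul_comm]

/-- The differential `d_S : C^1(G, Z(N)) → C^2(G, Z(N))`, written multiplicatively. -/
def d1 (S : G →* MulAut N) : (G → Subgroup.center N) →* (G × G → Subgroup.center N) where
  toFun f p := centerAut N (S p.1) (f p.2) / f (p.1 * p.2) * f p.1
  map_one' := by funext p; simp
  map_mul' f f' := by
    funext p
    simp only [Pi.mul_apply, map_mul, mul_div_mul_comm, mul_mul_mul_comm]

/-- The differential `d_S : C^2(G, Z(N)) → C^3(G, Z(N))`, written multiplicatively. -/
def d2 (S : G →* MulAut N) : (G × G → Subgroup.center N) →* (G × G × G → Subgroup.center N) where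
  toFun ω p := centerAut N (S p.1) (ω (p.2.1, p.2.2)) / ω (p.1 * p.2.1, p.2.2) *
    (ω (p.1, p.2.1 * p.2.2) / ω (p.1, p.2.1))
  map_one' := by funext p; simp
  map_mul' f f' := by
    funext p
    simp only [Pi.mul_apply, map_mul, mul_div_mul_comm, mul_mul_mul_comm]

/-- `Z^1_s(G, Z(N))_S`. -/
def Z1sZ (S : G →* MulAut N) : Subgroup (G → Subgroup.center N) := C1sZ 𝕜 G N ⊓ (d1 S).ker

/-- `Z^2_ss(G, Z(N))_S`. -/
def Z2ssZ (S : G →* MulAut N) : Subgroup (G × G → Subgroup.center N) := C2ssZ 𝕜 G N ⊓ (d2 S).ker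

/-- `B^2_s(G, Z(N))_S = d_S (C^1_s(G, Z(N)))`. -/
def B2sZ (S : G →* MulAut N) : Subgroup (G × G → Subgroup.center N) := (C1sZ 𝕜 G N).map (d1 S)

/-- The group `H^1_s(G, Z(N))_S`, the quotient of the cocycles by the coboundaries
`d_S (C^0_s(G, Z(N)))`, written multiplicatively. -/
abbrev H1sZ (S : G →* MulAut N) : Type _ := Z1sZ 𝕜 S ⧸ (d0 S).range.subgroupOf (Z1sZ 𝕜 S)

/-- The group `H^2_ss(G, Z(N))_S = Z^2_ss(G, Z(N))_S / B^2_s(G, Z(N))_S`, written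
multiplicatively. -/
abbrev H2ssZ (S : G →* MulAut N) : Type _ := Z2ssZ 𝕜 S ⧸ (B2sZ 𝕜 S).subgroupOf (Z2ssZ 𝕜 S)

end CenterCohomology

/-! ## Lie group extensions -/

/-- The underlying set `N × G` of the semidirect product `N ⋊_S G`. -/
def SemiProd {G N : Type*} [Group G] [Group N] (_S : G →* MulAut N) : Type _ := N × G

namespace SemiProd

variable {𝕜 : Type*} [RCLike 𝕜]
variable {G : Type*} [TopologicalSpace G] [Group G] [LCManifold 𝕜 G]
variable {N : Type*} [TopologicalSpace N] [Group N] [LCManifold 𝕜 N]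
variable (S : G →* MulAut N)

/-- The group structure `(n, g) (n', g') = (n S(g)(n'), g g')`. -/
instance instGroup {G N : Type*} [Group G] [Group N] (S : G →* MulAut N) : Group (SemiProd S) where
  mul p p' := (p.1 * S p.2 p'.1, p.2 * p'.2)
  one := ((1 : N), (1 : G))
  inv p := (S p.2⁻¹ p.1⁻¹, p.2⁻¹)
  mul_assoc a b c := by
    refine Prod.ext ?_ (mul_assoc a.2 b.2 c.2)
    change a.1 * S a.2 b.1 * S (a.2 * b.2) c.1 = a.1 * S a.2 (b.1 * S b.2 c.1)
    rw [map_mul, map_mul, MulAut.mul_apply, mul_assoc]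
  one_mul a := by
    refine Prod.ext ?_ (one_mul a.2)
    change 1 * S 1 a.1 = a.1
    rw [map_one, MulAut.one_apply, one_mul]
  mul_one a := by
    refine Prod.ext ?_ (mul_one a.2)
    change a.1 * S a.2 1 = a.1
    rw [map_one, mul_one]
  inv_mul_cancel a := by
    refine Prod.ext ?_ (inv_mul_cancel a.2)
    change S a.2⁻¹ a.1⁻¹ * S a.2⁻¹ a.1 = 1
    rw [← map_mul, inv_mul_cancel, map_one]

/-- The product topology. -/
instance instTopologicalSpace : TopologicalSpace (SemiProd S) :=
  inferInstanceAs (TopologicalSpace (N × G))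

/-- The product manifold structure. -/
instance instLCManifold : LCManifold 𝕜 (SemiProd S) :=
  inferInstanceAs (LCManifold 𝕜 (N × G))

variable {S}

theorem lcLieGroup [LCLieGroup 𝕜 G] [LCLieGroup 𝕜 N] (hS : Smooth 𝕜 (fun p : G × N => S p.1 p.2)) :
    LCLieGroup 𝕜 (SemiProd S) where
  smooth_mul := by
    let T := (N × G) × (N × G)
    have h1 : Smooth 𝕜 (fun p : T => p.1) := smooth_fst
    have h2 : Smooth 𝕜 (fun p : T => p.2) := smooth_snd
    have h11 : Smooth 𝕜 (fun p : T => p.1.1) := smooth_fst.comp h1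
    have h12 : Smooth 𝕜 (fun p : T => p.1.2) := smooth_snd.comp h1
    have h21 : Smooth 𝕜 (fun p : T => p.2.1) := smooth_fst.comp h2
    have h22 : Smooth 𝕜 (fun p : T => p.2.2) := smooth_snd.comp h2
    exact (h11.mul (hS.comp (h12.prodMk h21))).prodMk (h12.mul h22)
  smooth_inv := by
    have h1 : Smooth 𝕜 (fun p : N × G => p.1) := smooth_fst
    have h2 : Smooth 𝕜 (fun p : N × G => p.2) := smooth_snd
    exact (hS.comp (h2.inv.prodMk h1.inv)).prodMk h2.inv

variable (S) in
/-- The inclusion `n ↦ (n, 1)`. -/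
def incl : N →* SemiProd S where
  toFun n := (n, 1)
  map_one' := rfl
  map_mul' n n' := by
    refine Prod.ext ?_ (mul_one (1 : G)).symm
    change n * n' = n * S 1 n'
    rw [map_one, MulAut.one_apply]

variable (S) in
/-- The projection `(n, g) ↦ g`. -/
def proj : SemiProd S →* G where
  toFun p := p.2
  map_one' := rfl
  map_mul' _ _ := rfl

theorem isLieExtension [LCLieGroup 𝕜 G] (hS : Smooth 𝕜 (fun p : G × N => S p.1 p.2)) :
    IsLieExtension 𝕜 (incl S) (proj S) where
  smooth_ι := smooth_id.prodMk (smooth_const 1)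
  smooth_q := by
    have h : Smooth 𝕜 (fun p : N × G => p.2) := smooth_snd
    exact h
  injective n n' h := congrArg Prod.fst h
  surjective g := ⟨((1 : N), g), rfl⟩
  exact := by
    ext p
    constructor
    · intro hp
      exact ⟨p.1, Prod.ext rfl (Eq.symm hp)⟩
    · rintro ⟨n, rfl⟩
      rfl
  locally_trivial _ := by
    refine ⟨univ, trivial, fun g => ((1 : N), g), fun p => S p.2⁻¹ p.1,
      (smooth_const 1).prodMk smooth_id, fun _ _ => rfl, ?_, ?_⟩
    · have h1 : Smooth 𝕜 (fun p : N × G => p.1) := smooth_fst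
      have h2 : Smooth 𝕜 (fun p : N × G => p.2) := smooth_snd
      exact hS.comp (h2.inv.prodMk h1)
    · rintro ⟨n, g⟩ -
      refine Prod.ext ?_ (mul_one g).symm
      change n = 1 * S g (S g⁻¹ n)
      rw [one_mul, ← MulAut.mul_apply, ← map_mul, mul_inv_cancel, map_one, MulAut.one_apply]

end SemiProd

section Extensions

/-- A Lie group extension `1 → N → Ĝ → G → 1`. -/
structure LieExt (𝕜 : Type*) [RCLike 𝕜]
    (G : Type u) [TopologicalSpace G] [Group G] [LCManifold 𝕜 G]
    (N : Type v) [TopologicalSpace N] [Group N] [LCManifold 𝕜 N] where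
  carrier : Type (max u v)
  [topologicalSpace : TopologicalSpace carrier]
  [group : Group carrier]
  [lcManifold : LCManifold 𝕜 carrier]
  [lcLieGroup : LCLieGroup 𝕜 carrier]
  ι : N →* carrier
  q : carrier →* G
  isLieExtension : IsLieExtension 𝕜 ι q

attribute [instance] LieExt.topologicalSpace LieExt.group LieExt.lcManifold LieExt.lcLieGroup

variable {𝕜 : Type*} [RCLike 𝕜]
variable {G : Type u} [TopologicalSpace G] [Group G] [LCManifold 𝕜 G]
variable {N : Type v} [TopologicalSpace N] [Group N] [LCManifold 𝕜 N] [LCLieGroup 𝕜 N]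

/-- Equivalence of extensions: there is a morphism of Lie groups between them that induces the
identity on `N` and on `G`. -/
def LieExt.Equivalent (X Y : LieExt 𝕜 G N) : Prop :=
  ∃ φ : X.carrier →* Y.carrier, Smooth 𝕜 φ ∧ (∀ n, φ (X.ι n) = Y.ι n) ∧ ∀ x, Y.q (φ x) = X.q x

theorem LieExt.Equivalent.symm {X Y : LieExt 𝕜 G N} (h : X.Equivalent Y) : Y.Equivalent X := by
  obtain ⟨φ, hφ, hι, hq⟩ := h
  have hX := X.isLieExtension
  have hY := Y.isLieExtension
  have hqι : ∀ n, Y.q (Y.ι n) = 1 := fun n => by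
    have : Y.ι n ∈ Y.q.ker := hY.exact ▸ ⟨n, rfl⟩
    exact this
  have hinj : Function.Injective φ := by
    refine (injective_iff_map_eq_one φ).2 fun x hx => ?_
    have h1 : x ∈ X.q.ker := by
      rw [MonoidHom.mem_ker, ← hq, hx, map_one]
    rw [hX.exact] at h1
    obtain ⟨n, rfl⟩ := h1
    rw [hι] at hx
    rw [hY.injective (hx.trans (map_one _).symm), map_one]
  have hsurj : Function.Surjective φ := by
    intro y
    obtain ⟨x, hx⟩ := hX.surjective (Y.q y)
    have h1 : (φ x)⁻¹ * y ∈ Y.q.ker := by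
      rw [MonoidHom.mem_ker, map_mul, map_inv, hq, hx, inv_mul_cancel]
    rw [hY.exact] at h1
    obtain ⟨n, hn⟩ := h1
    exact ⟨x * X.ι n, by rw [map_mul, hι, hn, mul_inv_cancel_left]⟩
  let ψ := MulEquiv.ofBijective φ ⟨hinj, hsurj⟩
  have hψ : ∀ y, φ (ψ.symm y) = y := fun y => ψ.apply_symm_apply y
  refine ⟨ψ.symm.toMonoidHom, smooth_of_near fun y₀ => ?_, fun n => ?_, fun y => ?_⟩
  · obtain ⟨U, hbU, σ, -, hσ, hσq, -, -⟩ := hX.locally_trivial (Y.q y₀)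
    obtain ⟨V, h1V, τ, κ, -, -, hκ, hκτ⟩ := hY.locally_trivial 1
    have hU' : IsOpen (Y.q ⁻¹' U) := by
      simpa using hY.smooth_q.2.1.isOpen_inter_preimage isOpen_univ hσ.1
    have hs : SmoothOn 𝕜 (fun y => σ (Y.q y)) (Y.q ⁻¹' U) :=
      hσ.comp (hY.smooth_q.on hU') fun y hy => hy
    have hw : SmoothOn 𝕜 (fun y => (φ (σ (Y.q y)))⁻¹ * y) (Y.q ⁻¹' U) :=
      (hφ.comp_on hs).inv.mul (smooth_id.on hU')
    have hw1 : ∀ y ∈ Y.q ⁻¹' U, Y.q ((φ (σ (Y.q y)))⁻¹ * y) = 1 := fun y hy => by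
      rw [map_mul, map_inv, hq, hσq _ hy, inv_mul_cancel]
    have hk : SmoothOn 𝕜 (fun y => κ ((φ (σ (Y.q y)))⁻¹ * y)) (Y.q ⁻¹' U) :=
      hκ.comp hw fun y hy => by
        rw [mem_preimage, hw1 y hy]
        exact h1V
    have hr : SmoothOn 𝕜 (fun y => σ (Y.q y) * X.ι ((κ 1)⁻¹ * κ ((φ (σ (Y.q y)))⁻¹ * y)))
        (Y.q ⁻¹' U) :=
      hs.mul (hX.smooth_ι.comp_on (((smooth_const (κ 1)⁻¹).on hU').mul hk))
    refine ⟨Y.q ⁻¹' U, hbU, hr.congr fun y hy => hinj ?_⟩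
    have e1 : (1 : Y.carrier) = τ 1 * Y.ι (κ 1) := by
      have := hκτ 1 (by rw [map_one]; exact h1V)
      rwa [map_one] at this
    have e2 := hκτ ((φ (σ (Y.q y)))⁻¹ * y) (by rw [hw1 y hy]; exact h1V)
    rw [hw1 y hy, eq_inv_of_mul_eq_one_left e1.symm] at e2
    rw [map_mul, hι, map_mul, map_inv, ← e2, mul_inv_cancel_left]
    exact hψ y
  · apply hinj
    exact (hψ _).trans (hι n).symm
  · rw [← hq]
    exact congrArg Y.q (hψ y)

variable (𝕜 G N) in
/-- Equivalence of extensions is an equivalence relation. -/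
def LieExt.setoid : Setoid (LieExt 𝕜 G N) where
  r := LieExt.Equivalent
  iseqv :=
    { refl := fun X => ⟨MonoidHom.id _, smooth_id, fun _ => rfl, fun _ => rfl⟩
      symm := LieExt.Equivalent.symm
      trans := by
        rintro X Y Z ⟨φ, h1, h2, h3⟩ ⟨φ', h1', h2', h3'⟩
        exact ⟨φ'.comp φ, h1'.comp h1, fun n => (congrArg φ' (h2 n)).trans (h2' n),
          fun x => (h3' _).trans (h3 x)⟩ }

variable (𝕜 G N) in
/-- `Ext(G, N)`: the set of equivalence classes of Lie group extensions of `G` by `N`. -/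
def LieExtClass : Type _ := Quotient (LieExt.setoid 𝕜 G N)

/-- The class of an extension in `Ext(G, N)`. -/
def LieExt.cls (X : LieExt 𝕜 G N) : LieExtClass 𝕜 G N := Quotient.mk (LieExt.setoid 𝕜 G N) X

/-- The extension `N ⋊_S G` of `G` by `N` defined by a smooth action `S`. -/
def LieExt.semidirect [LCLieGroup 𝕜 G] (S : G →* MulAut N)
    (hS : Smooth 𝕜 (fun p : G × N => S p.1 p.2)) : LieExt 𝕜 G N where
  carrier := SemiProd S
  lcLieGroup := SemiProd.lcLieGroup hS
  ι := SemiProd.incl S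
  q := SemiProd.proj S
  isLieExtension := SemiProd.isLieExtension hS

/-- An extension is split if the projection has a section that is a morphism of Lie groups. -/
def LieExt.Split (X : LieExt 𝕜 G N) : Prop :=
  ∃ σ : G →* X.carrier, Smooth 𝕜 σ ∧ ∀ g, X.q (σ g) = g

/-- `(T, ω)` is the factor system of the extension `X` with respect to some normalized locally
smooth section `σ`: `T(g)` is the conjugation by `σ(g)` and `ω(g, g') = σ(g) σ(g') σ(g g')⁻¹`.
Equivalently, `X` is equivalent to the extension `N ×_(T, ω) G`, the set `N × G` with the
multiplication `(n, g) (n', g') = (n T(g)(n') ω(g, g'), g g')`. -/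
def LieExt.HasFactorSystem (X : LieExt 𝕜 G N) (T : G → MulAut N) (ω : G × G → N) : Prop :=
  ∃ σ : G → X.carrier, σ ∈ C1s 𝕜 G X.carrier ∧ (∀ g, X.q (σ g) = g) ∧
    (∀ g n, σ g * X.ι n * (σ g)⁻¹ = X.ι (T g n)) ∧
    ∀ g g', σ g * σ g' * (σ (g * g'))⁻¹ = X.ι (ω (g, g'))

variable (𝕜) in
/-- The equivalence `T ∼ T'` of outer actions: `T' = (C_N ∘ h) · T` for some `h ∈ C^1_s(G, N)`. -/
def OuterEquiv (T T' : G → MulAut N) : Prop :=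
  ∃ h ∈ C1s 𝕜 G N, ∀ g, T' g = MulAut.conj (h g) * T g

variable (𝕜) in
/-- `Ext(G, N)_[S]`: the classes of extensions corresponding to the `G`-kernel `[S]`. -/
def ExtKernel (S : G → MulAut N) : Set (LieExtClass 𝕜 G N) :=
  {x | ∃ X : LieExt 𝕜 G N, X.cls = x ∧
    ∃ T ω, X.HasFactorSystem T ω ∧ OuterEquiv 𝕜 S T}

variable (𝕜) in
/-- `Ext(G, N)_{[S], split}`: the classes in `Ext(G, N)_[S]` of split extensions. -/
def ExtKernelSplit (S : G → MulAut N) : Set (LieExtClass 𝕜 G N) :=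
  {x | x ∈ ExtKernel 𝕜 S ∧ ∃ X : LieExt 𝕜 G N, X.cls = x ∧ X.Split}

/-- The action `[β].[N ×_(S, ω) G] = [N ×_(S, ω β) G]` of `H^2_ss(G, Z(N))_S` on `Ext(G, N)_[S]`,
described by its graph: `ExtAct S c x y` means `y = c.x`. -/
def ExtAct (S : G →* MulAut N) (c : H2ssZ 𝕜 S) (x y : LieExtClass 𝕜 G N) : Prop :=
  ∃ (ω : G × G → N) (β : Z2ssZ 𝕜 S) (X Y : LieExt 𝕜 G N),
    QuotientGroup.mk β = c ∧ X.cls = x ∧ Y.cls = y ∧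
    X.HasFactorSystem S ω ∧ Y.HasFactorSystem S (fun p => ω p * (β.1 p : N))

end Extensions

/-! The exact sequence rests on two features of the nonabelian differential `dS S f` when its values
are central. Multiplying `f` by a central map `z` multiplies it by `d1 S z` (`dS_mul_of_central`),
and passing to another point of the `N`-orbit conjugates it by an element of `N`, hence does not
change it (`dS_gauge`). A cocycle with values in `N_ad` is lifted by composing it with a normalized
section of `q_N` that is smooth near `1`; the differential of the lift is trivial modulo the centre,
and it is a `2`-cocycle by associativity (`dS_cocycle`). Its class depends only on the orbit of the
given cocycle (`mk_centralCocycle_eq`), which defines `δ`. If the class is trivial, dividing the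
lift by a suitable `z` turns it into a genuine cocycle. The map `δ₀` is the same construction one
degree lower.

For the split extensions, let `σ` be a section with factor system `(S, ω)`. Every other section is
`ι(f)σ`, and it is a homomorphism exactly when `f(g) S(g)(f(g')) ω(g, g') = f(gg')`. Conjugation by
a homomorphic section makes `C_f S` an action, so `dS S f` is central (`conj_mul_action_iff`) and `ω
= (dS S f)⁻¹`; this inversion is the sign in front of `im δ`. Conversely, a central `dS S f` makes
`C_f S` a smooth action, and undoing the twist in its semidirect product gives a split extension
with factor system `(S, (dS S f)⁻¹)` (`LieExt.hasFactorSystem_twisted`). No extension has to be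
built from a general factor system. Since a factor system determines its extension up to equivalence
(`LieExt.HasFactorSystem.equivalent`), these are all the split classes. -/

/-! ### Smoothness near a point, and homomorphisms and actions smooth near the identity -/

section SmoothMaps

variable {𝕜 : Type*} [RCLike 𝕜]
variable {M : Type*} [TopologicalSpace M] [LCManifold 𝕜 M]
variable {M₁ : Type*} [TopologicalSpace M₁] [LCManifold 𝕜 M₁]

theorem SmoothNear.congr {f g : M → M₁} {x : M} (hf : SmoothNear 𝕜 f x) (h : g =ᶠ[𝓝 x] f) :
    SmoothNear 𝕜 g x := by
  obtain ⟨U, hxU, hU⟩ := hf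
  obtain ⟨V, hV, hVo, hxV⟩ := eventually_nhds_iff.1 h
  exact ⟨U ∩ V, ⟨hxU, hxV⟩,
    (hU.mono (hU.1.inter hVo) inter_subset_left).congr fun y hy => hV y hy.2⟩

theorem SmoothNear.continuousAt {f : M → M₁} {x : M} (hf : SmoothNear 𝕜 f x) :
    ContinuousAt f x := by
  obtain ⟨U, hxU, hU⟩ := hf
  exact hU.2.1.continuousAt (hU.1.mem_nhds hxU)

/-- A variant of `SmoothNear.comp` in which the base point of the outer map is a variable. -/
theorem SmoothNear.comp_of_eq {M₂ : Type*} [TopologicalSpace M₂] [LCManifold 𝕜 M₂]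
    {f : M → M₁} {g : M₁ → M₂} {x : M} {y : M₁} (hg : SmoothNear 𝕜 g y)
    (hf : SmoothNear 𝕜 f x) (hy : f x = y) : SmoothNear 𝕜 (fun x => g (f x)) x :=
  SmoothNear.comp (hy ▸ hg) hf

variable {G : Type*} [TopologicalSpace G] [Group G] [LCManifold 𝕜 G] [LCLieGroup 𝕜 G]
variable {H : Type*} [TopologicalSpace H] [Group H] [LCManifold 𝕜 H]

/-- A group homomorphism that is smooth near the identity is smooth. -/
theorem MonoidHom.smooth_of_smoothNear_one [LCLieGroup 𝕜 H] {φ : G →* H} (h : SmoothNear 𝕜 φ 1) :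
    Smooth 𝕜 φ := by
  refine smooth_of_near fun x => ?_
  have h1 : SmoothNear 𝕜 (fun y => φ (x⁻¹ * y)) x :=
    h.comp_of_eq (((smooth_const x⁻¹).mul smooth_id).near x) (inv_mul_cancel x)
  refine (((smooth_const (φ x)).near x).mul h1).congr (Eventually.of_forall fun y => ?_)
  simp

/-- An action by smooth automorphisms that is smooth near `{1} × H` is a smooth action. -/
theorem smooth_action_of_smoothNear_one {S : G →* MulAut H}
    (h1 : ∀ g, Smooth 𝕜 (fun x => S g x))
    (h : ∀ x, SmoothNear 𝕜 (fun p : G × H => S p.1 p.2) (1, x)) :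
    Smooth 𝕜 (fun p : G × H => S p.1 p.2) := by
  refine smooth_of_near fun p₀ => ?_
  -- With `g₀ = p₀.1`, factor `S(g) = S(g₀) S(g₀⁻¹g)`: the second factor is evaluated near the
  -- identity of `G`.
  have h2 : SmoothNear 𝕜 (fun p : G × H => S (p₀.1⁻¹ * p.1) p.2) p₀ :=
    (h p₀.2).comp_of_eq (f := fun p : G × H => (p₀.1⁻¹ * p.1, p.2))
      ((((smooth_const p₀.1⁻¹).mul smooth_fst).prodMk smooth_snd).near p₀)
      (by rw [inv_mul_cancel])
  refine ((h1 p₀.1).comp_near h2).congr (Eventually.of_forall fun p => ?_)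
  change S p.1 p.2 = S p₀.1 (S (p₀.1⁻¹ * p.1) p.2)
  rw [← MulAut.mul_apply, ← map_mul, mul_inv_cancel_left]

end SmoothMaps

/-! ### Universal properties of the fibre inclusion and the bundle projection -/

section PrincipalBundles

variable {𝕜 : Type*} [RCLike 𝕜]
variable {M : Type*} [TopologicalSpace M] [LCManifold 𝕜 M]
variable {H : Type*} [TopologicalSpace H] [Group H] [LCManifold 𝕜 H]
variable {P : Type*} [TopologicalSpace P] [Group P] [LCManifold 𝕜 P]
variable {B : Type*} [TopologicalSpace B] [Group B] [LCManifold 𝕜 B]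
variable {ι : H →* P} {q : P →* B}

theorem IsLieExtension.q_ι (h : IsLieExtension 𝕜 ι q) (x : H) : q (ι x) = 1 := by
  have : ι x ∈ q.ker := h.exact ▸ ⟨x, rfl⟩
  exact this

theorem IsLieExtension.exists_ι_eq (h : IsLieExtension 𝕜 ι q) {p : P} (hp : q p = 1) :
    ∃ x, ι x = p := by
  have : p ∈ q.ker := hp
  rwa [h.exact] at this

/-- A local section is continued by arbitrary preimages; a total section spares later arguments any
bookkeeping of domains. -/
theorem IsLieExtension.exists_section (h : IsLieExtension 𝕜 ι q) (b : B) :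
    ∃ σ : B → P, SmoothNear 𝕜 σ b ∧ ∀ x, q (σ x) = x := by
  classical
  obtain ⟨U, hbU, σ, -, hσ, hσq, -, -⟩ := h.locally_trivial b
  refine ⟨fun x => if x ∈ U then σ x else Function.surjInv h.surjective x,
    ⟨U, hbU, hσ.congr fun x hx => if_pos hx⟩, fun x => ?_⟩
  by_cases hx : x ∈ U
  · simp only [if_pos hx, hσq x hx]
  · simp only [if_neg hx, Function.surjInv_eq]

/-- The projection of a principal bundle of groups has normalized locally smooth sections. -/
theorem IsLieExtension.exists_section_mem_C1s [LCLieGroup 𝕜 P] (h : IsLieExtension 𝕜 ι q) :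
    ∃ σ ∈ C1s 𝕜 B P, ∀ x, q (σ x) = x := by
  obtain ⟨σ, hσ, hσq⟩ := h.exists_section 1
  -- `σ 1` lies in the kernel of `q`, so normalizing does not destroy the section property.
  refine ⟨fun x => σ x * (σ 1)⁻¹, ⟨mul_inv_cancel _, hσ.mul ((smooth_const _).near 1)⟩,
    fun x => ?_⟩
  rw [map_mul, map_inv, hσq, hσq, inv_one, mul_one]

/-- The fibre inclusion of a principal bundle of groups is initial for smooth maps. -/
theorem IsLieExtension.smoothNear_of_ι_comp [LCLieGroup 𝕜 H]
    (h : IsLieExtension 𝕜 ι q) {f : M → H} {x : M} (hf : SmoothNear 𝕜 (fun y => ι (f y)) x) :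
    SmoothNear 𝕜 f x := by
  obtain ⟨U, h1U, σ, κ, -, -, hκ, hκσ⟩ := h.locally_trivial 1
  have hU : ∀ y, q (ι y) ∈ U := fun y => by rwa [h.q_ι]
  have hn : SmoothNear 𝕜 (fun y => κ (ι (f y))) x :=
    SmoothNear.comp (g := κ) ⟨q ⁻¹' U, hU _, hκ⟩ hf
  -- The fibre over `1` is the image of `ι`. Comparing this identity with its case `y = 1` gives `y
  -- = κ(ι 1)⁻¹ κ(ι y)`, so `κ` recovers `f` from `ι ∘ f` up to a constant.
  have key : ∀ y, ι y = σ 1 * ι (κ (ι y)) := fun y => by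
    have := hκσ (ι y) (hU y)
    rwa [h.q_ι] at this
  refine (((smooth_const (κ (ι 1))⁻¹).near x).mul hn).congr (Eventually.of_forall fun y => ?_)
  apply h.injective
  have h1 := key 1
  rw [map_one, eq_comm, mul_eq_one_iff_eq_inv] at h1
  rw [map_mul, map_inv, map_one, ← h1, ← key]

/-- The bundle projection is final for smooth maps. -/
theorem IsLieExtension.smooth_of_comp_q (h : IsLieExtension 𝕜 ι q) {f : B → M}
    (hf : Smooth 𝕜 (fun p => f (q p))) : Smooth 𝕜 f := by
  refine smooth_of_near fun b => ?_
  obtain ⟨σ, hσ, hσq⟩ := h.exists_section b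
  exact (hf.comp_near hσ).congr (Eventually.of_forall fun x => congrArg f (hσq x).symm)

theorem IsLieExtension.smooth_of_comp_prod {M₁ : Type*} [TopologicalSpace M₁] [LCManifold 𝕜 M₁]
    (h : IsLieExtension 𝕜 ι q) {f : M₁ × B → M}
    (hf : Smooth 𝕜 (fun p : M₁ × P => f (p.1, q p.2))) : Smooth 𝕜 f := by
  refine smooth_of_near fun p₀ => ?_
  obtain ⟨σ, hσ, hσq⟩ := h.exists_section p₀.2
  have h1 : SmoothNear 𝕜 (fun p : M₁ × B => (p.1, σ p.2)) p₀ :=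
    (smooth_fst.near p₀).prodMk (hσ.comp (smooth_snd.near p₀))
  refine (hf.comp_near h1).congr (Eventually.of_forall fun p => ?_)
  simp only [hσq]

/-- The base of a principal bundle of groups with Lie group total space is a Lie group. -/
theorem IsLieExtension.lcLieGroup_base [LCLieGroup 𝕜 P] (h : IsLieExtension 𝕜 ι q) :
    LCLieGroup 𝕜 B where
  smooth_mul := by
    refine smooth_of_near fun p₀ => ?_
    obtain ⟨σ, hσ, hσq⟩ := h.exists_section p₀.1
    obtain ⟨τ, hτ, hτq⟩ := h.exists_section p₀.2
    have h1 : SmoothNear 𝕜 (fun p : B × B => σ p.1) p₀ := hσ.comp (smooth_fst.near p₀)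
    have h2 : SmoothNear 𝕜 (fun p : B × B => τ p.2) p₀ := hτ.comp (smooth_snd.near p₀)
    refine (h.smooth_q.comp_near (h1.mul h2)).congr (Eventually.of_forall fun p => ?_)
    simp only [map_mul, hσq, hτq]
  smooth_inv := by
    refine h.smooth_of_comp_q ?_
    have : Smooth 𝕜 (fun p : P => q p⁻¹) := h.smooth_q.comp (Smooth.inv smooth_id)
    simpa using this

end PrincipalBundles

/-! ### Algebra of the nonabelian differential modulo the centre -/

section CentralAlgebra

variable {G N : Type*} [Group G] [Group N]

theorem mul_mul_inv_of_central {x y z : N} (hx : x ∈ Subgroup.center N)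
    (hy : y ∈ Subgroup.center N) (hz : z ∈ Subgroup.center N) (a b c : N) :
    a * x * (b * y) * (c * z)⁻¹ = a * b * c⁻¹ * (y * z⁻¹ * x) := by
  have hw := (Subgroup.center N).mul_mem ((Subgroup.center N).mul_mem hy
    ((Subgroup.center N).inv_mem hz)) hx
  have h1 := Subgroup.mem_center_iff.1 hx
  have h2 := Subgroup.mem_center_iff.1 hw c⁻¹
  have h3 := h1 (y * z⁻¹)
  rw [mul_assoc (a * b), h2, h3, mul_inv_rev, ← mul_assoc, ← mul_assoc, mul_assoc a x b, ← h1 b]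
  simp only [mul_assoc]

theorem MulAut.conj_eq_one_iff {a : N} : MulAut.conj a = 1 ↔ a ∈ Subgroup.center N := by
  rw [Subgroup.mem_center_iff, MulEquiv.ext_iff]
  exact forall_congr' fun n => by
    rw [MulAut.conj_apply, MulAut.one_apply, mul_inv_eq_iff_eq_mul, eq_comm]

theorem MulAut.mul_conj (φ : MulAut N) (a : N) : φ * MulAut.conj a = MulAut.conj (φ a) * φ := by
  ext n
  simp

variable (S : G →* MulAut N)

theorem dS_mul (f : G → N) (g g' : G) :
    dS S f (g, g') * f (g * g') = f g * S g (f g') := by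
  simp [dS]

/-- Central factors move freely, so the choice of a lift from `N_ad` affects the differential only
by an abelian coboundary. -/
theorem dS_mul_of_central (f : G → N) {z : G → N} (hz : ∀ g, z g ∈ Subgroup.center N)
    (p : G × G) :
    dS S (fun g => f g * z g) p =
      dS S f p * (S p.1 (z p.2) * (z (p.1 * p.2))⁻¹ * z p.1) := by
  have h : S p.1 (z p.2) ∈ Subgroup.center N :=
    (centerAut N (S p.1) ⟨z p.2, hz p.2⟩).2
  simp only [dS, map_mul]
  exact mul_mul_inv_of_central (hz _) h (hz _) _ _ _

/-- The inner factors `S(g)(n)` telescope. When the differential is central the remaining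
conjugation is trivial. -/
theorem dS_gauge (f : G → N) (n : N) (p : G × G) :
    dS S (fun g => n * f g * (S g n)⁻¹) p = n * dS S f p * n⁻¹ := by
  simp [dS, mul_assoc]

/-- Moving `S(g)` past `C_{f(g')}` by `MulAut.mul_conj` shows that `g ↦ C_{f(g)} S(g)` fails to be
multiplicative exactly by conjugation with the differential of `f`. -/
theorem conj_mul_action_iff (f : G → N) (g g' : G) :
    MulAut.conj (f g) * S g * (MulAut.conj (f g') * S g') =
      MulAut.conj (f (g * g')) * S (g * g') ↔ dS S f (g, g') ∈ Subgroup.center N := by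
  have h : MulAut.conj (f g) * S g * (MulAut.conj (f g') * S g') =
      MulAut.conj (f g * S g (f g')) * S (g * g') := by
    rw [map_mul S, map_mul MulAut.conj, mul_assoc, ← mul_assoc (S g), MulAut.mul_conj]
    simp only [mul_assoc]
  rw [h, mul_left_inj, ← MulAut.conj_eq_one_iff, dS, map_mul MulAut.conj _ (f (g * g'))⁻¹,
    map_inv, mul_inv_eq_one]

/-- The cocycle identity for `d_S f` when it is central. -/
theorem dS_cocycle {f : G → N} (hf : ∀ p, dS S f p ∈ Subgroup.center N) (a b c : G) :
    S a (dS S f (b, c)) * dS S f (a, b * c) = dS S f (a, b) * dS S f (a * b, c) := by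
  have h : S a (dS S f (b, c)) ∈ Subgroup.center N :=
    (centerAut N (S a) ⟨dS S f (b, c), hf (b, c)⟩).2
  -- After multiplication by `f(abc)`, both sides unfold to `f(a) S(a)(f(b)) S(ab)(f(c))`. On the
  -- left, `S(a)` of the central element for `(b, c)` has to pass `f(a)`.
  refine mul_right_cancel (b := f (a * b * c)) ?_
  rw [mul_assoc, mul_assoc _ _ (f (a * b * c)), dS_mul, mul_assoc a b c, dS_mul, ← mul_assoc,
    ← Subgroup.mem_center_iff.1 h, mul_assoc, ← map_mul, dS_mul, ← mul_assoc, dS_mul, mul_assoc,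
    map_mul, map_mul]
  rfl

theorem d1_coe (z : G → Subgroup.center N) (p : G × G) :
    (d1 S z p : N) = S p.1 (z p.2) * ((z (p.1 * p.2) : N))⁻¹ * z p.1 := by
  change ((centerAut N (S p.1) (z p.2) / z (p.1 * p.2) * z p.1 : Subgroup.center N) : N) = _
  rw [div_eq_mul_inv]
  rfl

variable {S}

/-- The left side is how the second component of a factor system changes when the section is
multiplied by a central map. -/
theorem mul_action_mul_inv_of_central (z : G → Subgroup.center N) (w : N)
    (p : G × G) :
    z p.1 * S p.1 (z p.2) * w * ((z (p.1 * p.2) : N))⁻¹ = w * d1 S z p := by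
  have h1 := (centerAut N (S p.1) (z p.2)).2
  have h2 := Subgroup.mem_center_iff.1 ((Subgroup.center N).mul_mem (z p.1).2 h1) w
  have h3 := Subgroup.mem_center_iff.1 (z p.1).2 (S p.1 (z p.2) * ((z (p.1 * p.2) : N))⁻¹)
  change w * (z p.1 * S p.1 (z p.2)) = z p.1 * S p.1 (z p.2) * w at h2
  rw [d1_coe, ← h2, h3]
  simp only [mul_assoc]

/-- The action `g ↦ C_{f(g)} S(g)` obtained by twisting `S` with a map `f` for which `d_S f` is
central. -/
def twistedAction (S : G →* MulAut N) (f : G → N)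
    (hf : ∀ p, dS S f p ∈ Subgroup.center N) : G →* MulAut N :=
  MonoidHom.mk' (fun g => MulAut.conj (f g) * S g) fun g g' =>
    ((conj_mul_action_iff S f g g').2 (hf (g, g'))).symm

theorem mem_fixedPts_ad_iff {n : N} :
    (QuotientGroup.mk n : N ⧸ Subgroup.center N) ∈ fixedPts ((adAut N).comp S) ↔
      ∀ g, n⁻¹ * S g n ∈ Subgroup.center N := by
  refine forall_congr' fun g => ?_
  rw [eq_comm]
  exact QuotientGroup.eq (a := n) (b := S g n)

variable (S) in
/-- The inclusion `Z(N)^G → N^G`. -/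
def fixedIncl : fixedPts ((centerAut N).comp S) →* fixedPts S where
  toFun z := ⟨z.1.1, fun g => congrArg Subtype.val (z.2 g)⟩
  map_one' := rfl
  map_mul' _ _ := rfl

variable (S) in
/-- The map `N^G → N_ad^G` induced by the quotient map. -/
def fixedProj : fixedPts S →* fixedPts ((adAut N).comp S) where
  toFun n := ⟨QuotientGroup.mk n.1, fun g => congrArg QuotientGroup.mk (n.2 g)⟩
  map_one' := rfl
  map_mul' _ _ := rfl

theorem fixedProj_ker : (fixedProj S).ker = (fixedIncl S).range := by
  ext n
  have h1 : n ∈ (fixedProj S).ker ↔ n.1 ∈ Subgroup.center N := by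
    rw [MonoidHom.mem_ker, ← QuotientGroup.eq_one_iff, Subtype.ext_iff]
    rfl
  rw [h1]
  constructor
  · intro h
    exact ⟨⟨⟨n.1, h⟩, fun g => Subtype.ext (n.2 g)⟩, rfl⟩
  · rintro ⟨z, rfl⟩
    exact z.1.2

end CentralAlgebra

/-! ### Consequences of a smooth action -/

section SmoothActions

variable {𝕜 : Type*} [RCLike 𝕜]
variable {G : Type*} [TopologicalSpace G] [Group G] [LCManifold 𝕜 G]
variable {N : Type*} [TopologicalSpace N] [Group N] [LCManifold 𝕜 N]
variable {S : G →* MulAut N}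

theorem smooth_orbit (hS : Smooth 𝕜 (fun p : G × N => S p.1 p.2)) (n : N) :
    Smooth 𝕜 (fun g => S g n) :=
  hS.comp (smooth_id.prodMk (smooth_const n))

theorem smooth_translate (hS : Smooth 𝕜 (fun p : G × N => S p.1 p.2)) (g : G) :
    Smooth 𝕜 (fun n => S g n) :=
  hS.comp ((smooth_const g).prodMk smooth_id)

theorem smoothNear_conj [LCLieGroup 𝕜 G] {M : Type*} [TopologicalSpace M] [LCManifold 𝕜 M] (g : G)
    {f : G → M} (hf : SmoothNear 𝕜 f 1) :
    SmoothNear 𝕜 (fun x => f (g * x * g⁻¹)) 1 :=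
  hf.comp_of_eq ((((smooth_const g).mul smooth_id).mul (smooth_const g⁻¹)).near 1) (by simp)

theorem H1s.mk_eq_iff {A : Type*} [Group A] [TopologicalSpace A] [LCManifold 𝕜 A]
    {T : G →* MulAut A} {f f' : Z1s 𝕜 T} :
    H1s.mk 𝕜 T f = H1s.mk 𝕜 T f' ↔ ∃ n : A, ∀ g, f'.1 g = n * f.1 g * (T g n)⁻¹ :=
  Quotient.eq

theorem smooth_adAut [LCManifold 𝕜 (Subgroup.center N)] [LCLieGroup 𝕜 (Subgroup.center N)]
    [LCManifold 𝕜 (N ⧸ Subgroup.center N)]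
    (hZ : IsSplitLieSubgroup 𝕜 (Subgroup.center N))
    (hS : Smooth 𝕜 (fun p : G × N => S p.1 p.2)) :
    Smooth 𝕜 (fun p : G × (N ⧸ Subgroup.center N) => adAut N (S p.1) p.2) :=
  IsLieExtension.smooth_of_comp_prod hZ (hZ.smooth_q.comp hS)

end SmoothActions

/-! ### Central cocycles, the maps in degree one, and `δ₀` -/

section Connecting

variable {𝕜 : Type*} [RCLike 𝕜]
variable {G : Type*} [TopologicalSpace G] [Group G] [LCManifold 𝕜 G]
variable {N : Type*} [TopologicalSpace N] [Group N] [LCManifold 𝕜 N] [LCLieGroup 𝕜 N]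
variable {S : G →* MulAut N}

/-- The condition at a general `g` involves `f` near `g`, where it need not be smooth. The two
factors `f(gx)⁻¹` cancel, leaving only the constant `f(g)` and values of `f` at `x` and `gxg⁻¹`,
close to `1`. -/
theorem dS_mem_C2ss [LCLieGroup 𝕜 G] (hS : Smooth 𝕜 (fun p : G × N => S p.1 p.2)) {f : G → N}
    (hf : f ∈ C1s 𝕜 G N) : dS S f ∈ C2ss 𝕜 G N := by
  refine ⟨⟨fun g => ⟨?_, ?_⟩, ?_⟩, fun g => ?_⟩
  · simp [dS, hf.1]
  · simp [dS, hf.1]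
  · have h1 : SmoothNear 𝕜 (fun p : G × G => f p.1) (1, 1) :=
      hf.2.comp_of_eq (smooth_fst.near _) rfl
    have h2 : SmoothNear 𝕜 (fun p : G × G => f p.2) (1, 1) :=
      hf.2.comp_of_eq (smooth_snd.near _) rfl
    have h3 : SmoothNear 𝕜 (fun p : G × G => f (p.1 * p.2)) (1, 1) :=
      hf.2.comp_of_eq ((smooth_fst.mul smooth_snd).near _) (mul_one 1)
    exact (h1.mul (hS.comp_near ((smooth_fst.near _).prodMk h2))).mul h3.inv
  · have hc : SmoothNear 𝕜 (fun x : G => g * x * g⁻¹) 1 :=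
      (((smooth_const g).mul smooth_id).mul (smooth_const g⁻¹)).near 1
    have h1 : SmoothNear 𝕜 (fun x => f g * S g (f x)) 1 :=
      ((smooth_const (f g)).near 1).mul ((smooth_translate hS g).comp_near hf.2)
    have h2 : SmoothNear 𝕜 (fun x => S (g * x * g⁻¹) (f g)) 1 :=
      (smooth_orbit hS (f g)).comp_near hc
    refine (h1.mul ((smoothNear_conj g hf.2).mul h2).inv).congr (Eventually.of_forall fun x => ?_)
    simp [dS, mul_assoc]

/-- The `2`-cocycle `d_S f` with values in the centre. -/
def centralCocycle [LCLieGroup 𝕜 G] (hS : Smooth 𝕜 (fun p : G × N => S p.1 p.2)) (f : G → N)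
    (hf : f ∈ Z1sCentral 𝕜 S) : Z2ssZ 𝕜 S :=
  ⟨fun p => ⟨dS S f p, hf.2 p⟩, dS_mem_C2ss hS hf.1, by
    refine MonoidHom.mem_ker.2 (funext fun p => ?_)
    refine Subtype.ext ?_
    have h := dS_cocycle S hf.2 p.1 p.2.1 p.2.2
    let a : Subgroup.center N := centerAut N (S p.1) ⟨dS S f (p.2.1, p.2.2), hf.2 _⟩
    let b : Subgroup.center N := ⟨dS S f (p.1, p.2.1 * p.2.2), hf.2 _⟩
    let c : Subgroup.center N := ⟨dS S f (p.1, p.2.1), hf.2 _⟩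
    let d : Subgroup.center N := ⟨dS S f (p.1 * p.2.1, p.2.2), hf.2 _⟩
    have h' : a * b = c * d := Subtype.ext h
    have : a / d * (b / c) = 1 := by
      rw [div_mul_div_comm, h', mul_comm c d, div_self']
    exact congrArg Subtype.val this⟩

theorem mem_Z1sZ_iff {c : G → Subgroup.center N} :
    c ∈ Z1sZ 𝕜 S ↔ (fun g => (c g : N)) ∈ Z1s 𝕜 S := by
  have h : ∀ g g', d1 S c (g, g') = 1 ↔ (c (g * g') : N) = c g * S g (c g') := fun g g' => by
    have : d1 S c (g, g') = centerAut N (S g) (c g') / c (g * g') * c g := rfl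
    rw [this, div_mul_eq_mul_div, div_eq_one, eq_comm, mul_comm, Subtype.ext_iff]
    rfl
  constructor
  · rintro ⟨h1, h2⟩
    exact ⟨h1, fun g g' => (h g g').1 (congrFun h2 (g, g'))⟩
  · rintro ⟨h1, h2⟩
    exact ⟨h1, funext fun p => (h p.1 p.2).2 (h2 p.1 p.2)⟩

theorem mk_Z2ssZ_eq_iff {β β' : Z2ssZ 𝕜 S} :
    (QuotientGroup.mk β : H2ssZ 𝕜 S) = QuotientGroup.mk β' ↔
      ∃ z ∈ C1sZ 𝕜 G N, ∀ p, (β'.1 p : N) = β.1 p * d1 S z p := by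
  rw [QuotientGroup.eq, Subgroup.mem_subgroupOf]
  refine exists_congr fun z => and_congr_right fun _ => ?_
  rw [funext_iff]
  refine forall_congr' fun p => ?_
  have : (β⁻¹ * β' : Z2ssZ 𝕜 S).1 p = (β.1 p)⁻¹ * β'.1 p := rfl
  rw [this, eq_inv_mul_iff_mul_eq, eq_comm, Subtype.ext_iff]
  rfl

theorem mk_Z1sZ_eq_iff {c c' : Z1sZ 𝕜 S} :
    (QuotientGroup.mk c : H1sZ 𝕜 S) = QuotientGroup.mk c' ↔
      ∃ z : Subgroup.center N, ∀ g, (c'.1 g : N) = c.1 g * (S g z * (z : N)⁻¹) := by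
  rw [QuotientGroup.eq, Subgroup.mem_subgroupOf]
  refine exists_congr fun z => ?_
  rw [funext_iff]
  refine forall_congr' fun g => ?_
  have h1 : (c⁻¹ * c' : Z1sZ 𝕜 S).1 g = (c.1 g)⁻¹ * c'.1 g := rfl
  have h2 : d0 S z g = centerAut N (S g) z * z⁻¹ := div_eq_mul_inv _ _
  rw [h1, h2, eq_inv_mul_iff_mul_eq, eq_comm, Subtype.ext_iff]
  rfl

/-- The quotient of `f'` by the translate of `f` is a central map, smooth near `1`, and the two
cocycles differ by its coboundary. This gives independence of the lift (`n = 1`) and of the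
representative at once. -/
theorem mk_centralCocycle_eq [LCLieGroup 𝕜 G]
    (hS : Smooth 𝕜 (fun p : G × N => S p.1 p.2)) {f f' : G → N}
    (hf : f ∈ Z1sCentral 𝕜 S) (hf' : f' ∈ Z1sCentral 𝕜 S) (n : N)
    (h : ∀ g, (QuotientGroup.mk (f' g) : N ⧸ Subgroup.center N) =
      QuotientGroup.mk (n * f g * (S g n)⁻¹)) :
    (QuotientGroup.mk (centralCocycle hS f hf) : H2ssZ 𝕜 S) =
      QuotientGroup.mk (centralCocycle hS f' hf') := by
  have hz : ∀ g, (n * f g * (S g n)⁻¹)⁻¹ * f' g ∈ Subgroup.center N := fun g =>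
    QuotientGroup.eq.1 (h g).symm
  refine mk_Z2ssZ_eq_iff.2 ⟨fun g => ⟨_, hz g⟩, ⟨?_, ?_⟩, fun p => ?_⟩
  · simp [hf.1.1, hf'.1.1]
  · exact ((((smooth_const n).near 1).mul hf.1.2).mul ((smooth_orbit hS n).near 1).inv).inv.mul
      hf'.1.2
  · have h1 := dS_mul_of_central S (fun g => n * f g * (S g n)⁻¹) hz p
    rw [dS_gauge, Subgroup.mem_center_iff.1 (hf.2 p) n, mul_inv_cancel_right] at h1
    rw [d1_coe]
    refine Eq.trans ?_ h1
    simp only [mul_inv_cancel_left]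
    rfl

/-- The map `H^1_s(G, Z(N)) → H^1_s(G, N)`. -/
def H1sZ.toH1s : H1sZ 𝕜 S → H1s 𝕜 S :=
  Quotient.lift (s := QuotientGroup.leftRel _)
    (fun c : Z1sZ 𝕜 S => H1s.mk 𝕜 S ⟨fun g => (c.1 g : N), mem_Z1sZ_iff.1 c.2⟩) fun c c' h => by
      obtain ⟨z, hz⟩ := mk_Z1sZ_eq_iff.1 (Quotient.sound h)
      -- The inverse appears because `d0` is `S(g)(z) z⁻¹`, while the orbit action by `n`
      -- contributes `n S(g)(n)⁻¹`.
      refine H1s.mk_eq_iff.2 ⟨(z : N)⁻¹, fun g => ?_⟩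
      have hSz : S g (z : N)⁻¹ = (S g z)⁻¹ := map_inv _ _
      have h1 := Subgroup.mem_center_iff.1 ((Subgroup.center N).inv_mem z.2)
      change (c'.1 g : N) = (z : N)⁻¹ * c.1 g * (S g (z : N)⁻¹)⁻¹
      rw [hz g, hSz, inv_inv, ← h1, mul_assoc, h1]

theorem H1sZ.toH1s_eq_base_iff_exists (c : Z1sZ 𝕜 S) :
    H1sZ.toH1s (QuotientGroup.mk c : H1sZ 𝕜 S) = H1s.base 𝕜 S ↔
      ∃ n : N, ∀ g, (c.1 g : N) = n⁻¹ * S g n := by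
  constructor
  · intro h
    obtain ⟨n, hn⟩ := H1s.mk_eq_iff.1 h.symm
    refine ⟨n⁻¹, fun g => ?_⟩
    have h1 : (c.1 g : N) = n * 1 * (S g n)⁻¹ := hn g
    rw [h1, mul_one, inv_inv, map_inv]
  · rintro ⟨n, hn⟩
    refine Eq.symm (H1s.mk_eq_iff.2 ⟨n⁻¹, fun g => ?_⟩)
    change (c.1 g : N) = n⁻¹ * 1 * (S g n⁻¹)⁻¹
    rw [hn g, mul_one, map_inv, inv_inv]

/-- The cocycle `g ↦ n⁻¹ S(g)(n)` for an element `n` that is `G`-fixed modulo the centre. -/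
def fixedCocycle (hS : Smooth 𝕜 (fun p : G × N => S p.1 p.2)) (n : N)
    (hn : ∀ g, n⁻¹ * S g n ∈ Subgroup.center N) : Z1sZ 𝕜 S :=
  ⟨fun g => ⟨n⁻¹ * S g n, hn g⟩, mem_Z1sZ_iff.2 ⟨⟨by simp,
    ((smooth_const n⁻¹).near 1).mul ((smooth_orbit hS n).near 1)⟩, fun g g' => by
      simp [mul_assoc]⟩⟩

/-- Write `nm = kz` with `z` central. As `n⁻¹S(g)(n)` is central it passes `m⁻¹`, so the cocycles of
`n` and `m` multiply to that of `nm`, which differs from that of `k` by `d0 S z`. Stated for any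
representative `k` of the product, this yields both well-definedness and multiplicativity of `δ₀`.
-/
theorem mk_fixedCocycle_eq_mul (hS : Smooth 𝕜 (fun p : G × N => S p.1 p.2)) {n m k : N}
    (hn : ∀ g, n⁻¹ * S g n ∈ Subgroup.center N) (hm : ∀ g, m⁻¹ * S g m ∈ Subgroup.center N)
    (hk : ∀ g, k⁻¹ * S g k ∈ Subgroup.center N)
    (h : (QuotientGroup.mk k : N ⧸ Subgroup.center N) = QuotientGroup.mk (n * m)) :
    (QuotientGroup.mk (fixedCocycle hS k hk) : H1sZ 𝕜 S) =
      QuotientGroup.mk (fixedCocycle hS n hn * fixedCocycle hS m hm) := by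
  have hz := QuotientGroup.eq.1 h
  obtain ⟨z, hz'⟩ : ∃ z : Subgroup.center N, n * m = k * z :=
    ⟨⟨_, hz⟩, (mul_inv_cancel_left _ _).symm⟩
  refine mk_Z1sZ_eq_iff.2 ⟨z, fun g => ?_⟩
  change n⁻¹ * S g n * (m⁻¹ * S g m) = k⁻¹ * S g k * (S g z * (z : N)⁻¹)
  have h1 := Subgroup.mem_center_iff.1 (hn g) m⁻¹
  have h2 := Subgroup.mem_center_iff.1 ((Subgroup.center N).inv_mem z.2) (k⁻¹ * S g k * S g z)
  rw [← mul_assoc, ← h1, ← mul_assoc _ (S g z), h2]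
  calc m⁻¹ * (n⁻¹ * S g n) * S g m = (n * m)⁻¹ * S g (n * m) := by simp [mul_assoc]
    _ = _ := by rw [hz']; simp [mul_assoc]

/-- The connecting homomorphism `δ₀ : N_ad^G → H^1_s(G, Z(N))`. -/
noncomputable def connectingHom (hS : Smooth 𝕜 (fun p : G × N => S p.1 p.2)) :
    fixedPts ((adAut N).comp S) →* H1sZ 𝕜 S :=
  MonoidHom.mk' (fun x => QuotientGroup.mk (fixedCocycle hS x.1.out
    (mem_fixedPts_ad_iff.1 (by rw [QuotientGroup.out_eq']; exact x.2)))) fun x y =>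
      mk_fixedCocycle_eq_mul hS _ _ _ (by
        rw [QuotientGroup.mk_mul, QuotientGroup.out_eq', QuotientGroup.out_eq',
          QuotientGroup.out_eq']
        rfl)

/-- The case `m = 1` of `mk_fixedCocycle_eq_mul` frees the value from the chosen representative. -/
theorem connectingHom_apply (hS : Smooth 𝕜 (fun p : G × N => S p.1 p.2))
    (x : fixedPts ((adAut N).comp S)) {n : N} (hn : QuotientGroup.mk n = x.1)
    (hn' : ∀ g, n⁻¹ * S g n ∈ Subgroup.center N) :
    connectingHom hS x = QuotientGroup.mk (fixedCocycle hS n hn') := by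
  have h1 : ∀ g : G, (1 : N)⁻¹ * S g 1 ∈ Subgroup.center N := fun g => by simp
  have h2 : fixedCocycle hS 1 h1 = 1 := Subtype.ext (funext fun g => Subtype.ext (by
    change (1 : N)⁻¹ * S g 1 = 1
    simp))
  refine (mk_fixedCocycle_eq_mul hS hn' h1 _ ?_).trans ?_
  · rw [mul_one, hn, QuotientGroup.out_eq']
  · rw [h2, mul_one]

theorem H1sZ.toH1s_eq_base_iff (hS : Smooth 𝕜 (fun p : G × N => S p.1 p.2)) (c : H1sZ 𝕜 S) :
    H1sZ.toH1s c = H1s.base 𝕜 S ↔ c ∈ (connectingHom hS).range := by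
  obtain ⟨c, rfl⟩ := QuotientGroup.mk_surjective c
  rw [H1sZ.toH1s_eq_base_iff_exists]
  constructor
  · rintro ⟨n, hn⟩
    have hn' : ∀ g, n⁻¹ * S g n ∈ Subgroup.center N := fun g => hn g ▸ (c.1 g).2
    refine ⟨⟨QuotientGroup.mk n, mem_fixedPts_ad_iff.2 hn'⟩, ?_⟩
    rw [connectingHom_apply hS _ rfl hn']
    exact congrArg QuotientGroup.mk (Subtype.ext (funext fun g => Subtype.ext (hn g).symm))
  · rintro ⟨x, hx⟩
    obtain ⟨n, hn⟩ := QuotientGroup.mk_surjective x.1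
    have hn' := mem_fixedPts_ad_iff.1 (hn.symm ▸ x.2 : QuotientGroup.mk n ∈ _)
    rw [connectingHom_apply hS x hn hn'] at hx
    obtain ⟨z, hz⟩ := mk_Z1sZ_eq_iff.1 hx
    -- The coboundary of `z` is absorbed by replacing the representative `n` of `x` with `nz`.
    refine ⟨n * z, fun g => ?_⟩
    have h2 := Subgroup.mem_center_iff.1 ((Subgroup.center N).inv_mem z.2) (n⁻¹ * S g n * S g z)
    rw [hz g]
    change n⁻¹ * S g n * (S g z * (z : N)⁻¹) = _
    rw [← mul_assoc _ (S g z), h2]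
    simp [mul_assoc]

theorem connectingHom_ker (hS : Smooth 𝕜 (fun p : G × N => S p.1 p.2)) :
    (connectingHom hS).ker = (fixedProj S).range := by
  ext x
  constructor
  · intro h
    obtain ⟨n, hn⟩ := QuotientGroup.mk_surjective x.1
    have hn' := mem_fixedPts_ad_iff.1 (hn.symm ▸ x.2 : QuotientGroup.mk n ∈ _)
    rw [MonoidHom.mem_ker, connectingHom_apply hS x hn hn'] at h
    obtain ⟨z, hz⟩ := mk_Z1sZ_eq_iff.1 (h : _ = (QuotientGroup.mk (1 : Z1sZ 𝕜 S) : H1sZ 𝕜 S))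
    -- Triviality of the class says that `n⁻¹S(g)(n)` is cancelled by the coboundary of `z`, that
    -- is, that `nz` is fixed by `G`.
    refine ⟨⟨n * z, fun g => ?_⟩, Subtype.ext ?_⟩
    · have h1 : 1 = n⁻¹ * S g n * (S g z * (z : N)⁻¹) := hz g
      have h2 := Subgroup.mem_center_iff.1 ((Subgroup.center N).inv_mem z.2) (n⁻¹ * S g n * S g z)
      rw [← mul_assoc _ (S g z), h2] at h1
      have h3 := congrArg (fun y => n * (z * y)) h1
      simpa [mul_assoc] using h3.symm
    · rw [← hn, eq_comm]
      exact QuotientGroup.eq.2 (by simp)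
  · rintro ⟨n, rfl⟩
    have h1 : ∀ g, n.1⁻¹ * S g n.1 = 1 := fun g => by rw [n.2 g, inv_mul_cancel]
    rw [MonoidHom.mem_ker, connectingHom_apply hS _ rfl fun g => h1 g ▸ one_mem _]
    exact congrArg QuotientGroup.mk
      (Subtype.ext (funext fun g => Subtype.ext (h1 g)) : fixedCocycle hS n.1 _ = 1)

/-! ### Lifting cocycles from `N_ad`, the map `δ`, and exactness -/

variable [LCManifold 𝕜 (Subgroup.center N)] [LCLieGroup 𝕜 (Subgroup.center N)]
  [LCManifold 𝕜 (N ⧸ Subgroup.center N)]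

theorem exists_lift_mem_Z1sCentral (hZ : IsSplitLieSubgroup 𝕜 (Subgroup.center N))
    (f : Z1s 𝕜 ((adAut N).comp S)) :
    ∃ fh ∈ Z1sCentral 𝕜 S, ∀ g, QuotientGroup.mk (fh g) = f.1 g := by
  obtain ⟨σ, hσ, hσq⟩ := IsLieExtension.exists_section_mem_C1s hZ
  replace hσq : ∀ x, (QuotientGroup.mk (σ x) : N ⧸ Subgroup.center N) = x := hσq
  refine ⟨fun g => σ (f.1 g), ⟨⟨?_, hσ.2.comp_of_eq f.2.1.2 f.2.1.1⟩, fun p => ?_⟩,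
    fun g => hσq _⟩
  · change σ (f.1 1) = 1
    rw [f.2.1.1, hσ.1]
  -- Centrality is triviality in `N_ad`, where the expression becomes the differential of the
  -- cocycle `f`.
  · rw [← QuotientGroup.eq_one_iff]
    change (QuotientGroup.mk (σ (f.1 p.1)) : N ⧸ Subgroup.center N) *
      adAut N (S p.1) (QuotientGroup.mk (σ (f.1 p.2))) *
      (QuotientGroup.mk (σ (f.1 (p.1 * p.2))))⁻¹ = 1
    rw [hσq, hσq, hσq, f.2.2, mul_inv_eq_one]
    rfl

/-- The image in `Z^1_s(G, N_ad)` of a map in `Z^1_s(G, N, Z(N))`. -/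
def adCocycle (hZ : IsSplitLieSubgroup 𝕜 (Subgroup.center N)) (f : G → N)
    (hf : f ∈ Z1sCentral 𝕜 S) : Z1s 𝕜 ((adAut N).comp S) :=
  ⟨fun g => QuotientGroup.mk (f g), ⟨congrArg QuotientGroup.mk hf.1.1,
    hZ.smooth_q.comp_near hf.1.2⟩, fun g g' => by
      refine (QuotientGroup.eq.2 ?_ : (QuotientGroup.mk (f (g * g')) : N ⧸ Subgroup.center N) =
        QuotientGroup.mk (f g * S g (f g')))
      rw [← dS_mul S, ← Subgroup.mem_center_iff.1 (hf.2 (g, g')), inv_mul_cancel_left]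
      exact hf.2 _⟩

/-- The connecting map `δ : H^1_s(G, N_ad) → H^2_ss(G, Z(N))`. -/
noncomputable def connectingMap [LCLieGroup 𝕜 G] (hZ : IsSplitLieSubgroup 𝕜 (Subgroup.center N))
    (hS : Smooth 𝕜 (fun p : G × N => S p.1 p.2)) :
    H1s 𝕜 ((adAut N).comp S) → H2ssZ 𝕜 S :=
  Quotient.lift (s := H1s.setoid 𝕜 ((adAut N).comp S))
    (fun f => QuotientGroup.mk (centralCocycle hS _
      (exists_lift_mem_Z1sCentral hZ f).choose_spec.1))
    fun f f' ⟨n, hn⟩ => by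
      obtain ⟨n, rfl⟩ := QuotientGroup.mk_surjective n
      refine mk_centralCocycle_eq hS _ _ n fun g => ?_
      have h1 := (exists_lift_mem_Z1sCentral hZ f).choose_spec.2 g
      have h2 := (exists_lift_mem_Z1sCentral hZ f').choose_spec.2 g
      rw [h2, hn g, ← h1]
      rfl

theorem connectingMap_mk [LCLieGroup 𝕜 G] (hZ : IsSplitLieSubgroup 𝕜 (Subgroup.center N))
    (hS : Smooth 𝕜 (fun p : G × N => S p.1 p.2)) (f : Z1s 𝕜 ((adAut N).comp S))
    {fh : G → N} (hfh : fh ∈ Z1sCentral 𝕜 S) (h : ∀ g, QuotientGroup.mk (fh g) = f.1 g) :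
    connectingMap hZ hS (H1s.mk 𝕜 _ f) = QuotientGroup.mk (centralCocycle hS fh hfh) := by
  refine mk_centralCocycle_eq hS _ _ 1 fun g => ?_
  rw [map_one, inv_one, one_mul, mul_one, h g]
  exact ((exists_lift_mem_Z1sCentral hZ f).choose_spec.2 g).symm

/-- The map `Z^1_s(G, N) → Z^1_s(G, N_ad)`. -/
def adZ1s (hZ : IsSplitLieSubgroup 𝕜 (Subgroup.center N)) (f : Z1s 𝕜 S) :
    Z1s 𝕜 ((adAut N).comp S) :=
  ⟨fun g => QuotientGroup.mk (f.1 g), ⟨congrArg QuotientGroup.mk f.2.1.1,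
    hZ.smooth_q.comp_near f.2.1.2⟩, fun g g' => congrArg QuotientGroup.mk (f.2.2 g g')⟩

/-- The map `H^1_s(G, N) → H^1_s(G, N_ad)`. -/
def H1s.toAd (hZ : IsSplitLieSubgroup 𝕜 (Subgroup.center N)) :
    H1s 𝕜 S → H1s 𝕜 ((adAut N).comp S) :=
  Quotient.lift (s := H1s.setoid 𝕜 S) (fun f => H1s.mk 𝕜 _ (adZ1s hZ f)) fun _ _ ⟨n, hn⟩ =>
    H1s.mk_eq_iff.2 ⟨QuotientGroup.mk n, fun g => congrArg QuotientGroup.mk (hn g)⟩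

/-- If the differential of a lift `fh` equals `d1 S z`, then `fh z⁻¹` is a crossed homomorphism with
the same image in `N_ad`. Conversely, a genuine cocycle is its own lift and has trivial
differential. -/
theorem connectingMap_eq_one_iff [LCLieGroup 𝕜 G] (hZ : IsSplitLieSubgroup 𝕜 (Subgroup.center N))
    (hS : Smooth 𝕜 (fun p : G × N => S p.1 p.2)) (y : H1s 𝕜 ((adAut N).comp S)) :
    connectingMap hZ hS y = 1 ↔ y ∈ range (H1s.toAd (S := S) hZ) := by
  constructor
  · obtain ⟨f, rfl⟩ := Quotient.exists_rep y
    obtain ⟨fh, hfh, h⟩ := exists_lift_mem_Z1sCentral hZ f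
    intro h1
    have h2 : (QuotientGroup.mk 1 : H2ssZ 𝕜 S) = QuotientGroup.mk (centralCocycle hS fh hfh) :=
      h1.symm.trans (connectingMap_mk hZ hS f hfh h)
    obtain ⟨z, hz, hd⟩ := mk_Z2ssZ_eq_iff.1 h2
    have hzi := (C1sZ 𝕜 G N).inv_mem hz
    have hzc : ∀ g, ((z⁻¹ g : Subgroup.center N) : N) ∈ Subgroup.center N := fun g => (z⁻¹ g).2
    have h3 : ∀ p, dS S (fun g => fh g * (z⁻¹ g : Subgroup.center N)) p = 1 := fun p => by
      rw [dS_mul_of_central S fh hzc, ← d1_coe, map_inv]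
      have h4 : dS S fh p = d1 S z p := (hd p).trans (one_mul _)
      rw [h4]
      exact mul_inv_cancel _
    refine ⟨H1s.mk 𝕜 S ⟨fun g => fh g * (z⁻¹ g : Subgroup.center N), ⟨?_, hfh.1.2.mul hzi.2⟩,
      fun g g' => (mul_inv_eq_one.1 (h3 (g, g'))).symm⟩, H1s.mk_eq_iff.2 ⟨1, fun g => ?_⟩⟩
    · change fh 1 * ((z⁻¹ 1 : Subgroup.center N) : N) = 1
      rw [hfh.1.1, show ((z⁻¹ 1 : Subgroup.center N) : N) = 1 from hzi.1, mul_one]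
    · rw [map_one, inv_one, one_mul, mul_one, ← h g]
      refine QuotientGroup.eq.2 ?_
      change (fh g)⁻¹ * (fh g * (z⁻¹ g : Subgroup.center N)) ∈ Subgroup.center N
      rw [inv_mul_cancel_left]
      exact hzc g
  · rintro ⟨x, rfl⟩
    obtain ⟨f, rfl⟩ := Quotient.exists_rep x
    have h1 : ∀ p, dS S f.1 p = 1 := fun p => mul_inv_eq_one.2 (f.2.2 p.1 p.2).symm
    have hf : f.1 ∈ Z1sCentral 𝕜 S := ⟨f.2.1, fun p => h1 p ▸ one_mem _⟩
    refine (connectingMap_mk hZ hS (adZ1s hZ f) hf fun g => rfl).trans ?_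
    have : centralCocycle hS f.1 hf = 1 := Subtype.ext (funext fun p => Subtype.ext (h1 p))
    rw [this]
    rfl


/-- If `n` trivializes the image in `N_ad`, acting on the cocycle by a lift of `n` makes all its
values central without leaving the orbit. -/
theorem H1s.toAd_eq_base_iff (hZ : IsSplitLieSubgroup 𝕜 (Subgroup.center N))
    (hS : Smooth 𝕜 (fun p : G × N => S p.1 p.2)) (x : H1s 𝕜 S) :
    H1s.toAd hZ x = H1s.base 𝕜 ((adAut N).comp S) ↔ x ∈ range (H1sZ.toH1s (S := S)) := by
  constructor
  · obtain ⟨f, rfl⟩ := Quotient.exists_rep x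
    intro h
    obtain ⟨n, hn⟩ := H1s.mk_eq_iff.1 h
    obtain ⟨n, rfl⟩ := QuotientGroup.mk_surjective n
    have hc : ∀ g, n * f.1 g * (S g n)⁻¹ ∈ Subgroup.center N := fun g =>
      (QuotientGroup.eq_one_iff _).1 (hn g).symm
    let c : G → Subgroup.center N := fun g => ⟨n * f.1 g * (S g n)⁻¹, hc g⟩
    have hcz : c ∈ Z1sZ 𝕜 S := by
      refine mem_Z1sZ_iff.2 ⟨⟨?_, (((smooth_const n).near 1).mul f.2.1.2).mul
        ((smooth_orbit hS n).near 1).inv⟩, fun g g' => ?_⟩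
      · simp [c, f.2.1.1]
      · simp [c, f.2.2, mul_assoc]
    refine ⟨QuotientGroup.mk ⟨c, hcz⟩, H1s.mk_eq_iff.2 ⟨n⁻¹, fun g => ?_⟩⟩
    change f.1 g = n⁻¹ * (n * f.1 g * (S g n)⁻¹) * (S g n⁻¹)⁻¹
    simp [mul_assoc]
  · rintro ⟨c, rfl⟩
    obtain ⟨c, rfl⟩ := QuotientGroup.mk_surjective c
    refine H1s.mk_eq_iff.2 ⟨1, fun g => ?_⟩
    rw [map_one, inv_one, one_mul, mul_one]
    exact ((QuotientGroup.eq_one_iff _).2 (c.1 g).2).symm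

end Connecting

/-! ### Factor systems, equivalence of extensions, and splittings -/

section FactorSystems

variable {𝕜 : Type*} [RCLike 𝕜]
variable {G : Type*} [TopologicalSpace G] [Group G] [LCManifold 𝕜 G]
variable {N : Type*} [TopologicalSpace N] [Group N] [LCManifold 𝕜 N]

/-- The multiplication rule for elements in the normal form `ι(n)σ(g)`; comparisons of sections and
extensions reduce to it. -/
theorem LieExt.mul_of_factor {X : LieExt 𝕜 G N} {σ : G → X.carrier} {T : G → MulAut N}
    {ω : G × G → N} (hT : ∀ g n, σ g * X.ι n * (σ g)⁻¹ = X.ι (T g n))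
    (hω : ∀ g g', σ g * σ g' * (σ (g * g'))⁻¹ = X.ι (ω (g, g'))) (n n' : N) (g g' : G) :
    X.ι n * σ g * (X.ι n' * σ g') = X.ι (n * T g n' * ω (g, g')) * σ (g * g') := by
  simp only [map_mul, ← hT, ← hω]
  group

theorem LieExt.ι_conj_mul {X : LieExt 𝕜 G N} {σ : G → X.carrier} {T : G → MulAut N}
    (hT : ∀ g n, σ g * X.ι n * (σ g)⁻¹ = X.ι (T g n)) (h : G → N) (g : G) (n : N) :
    X.ι (h g) * σ g * X.ι n * (X.ι (h g) * σ g)⁻¹ = X.ι ((MulAut.conj (h g) * T g) n) := by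
  simp only [MulAut.mul_apply, MulAut.conj_apply, map_mul, map_inv, ← hT]
  group

theorem C1s_inv [LCLieGroup 𝕜 N] {f : G → N} (hf : f ∈ C1s 𝕜 G N) :
    (fun g => (f g)⁻¹) ∈ C1s 𝕜 G N :=
  ⟨inv_eq_one.2 hf.1, hf.2.inv⟩

theorem LieExt.HasFactorSystem.of_equivalent {X Y : LieExt 𝕜 G N} {T : G → MulAut N}
    {ω : G × G → N} (h : X.HasFactorSystem T ω) (e : X.Equivalent Y) : Y.HasFactorSystem T ω := by
  obtain ⟨σ, hσ, hq, hT, hω⟩ := h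
  obtain ⟨φ, hφ, hι, hφq⟩ := e
  refine ⟨fun g => φ (σ g), ⟨?_, hφ.comp_near hσ.2⟩, fun g => (hφq _).trans (hq g),
    fun g n => ?_, fun g g' => ?_⟩
  · change φ (σ 1) = 1
    rw [hσ.1, map_one]
  · rw [← hι, ← hι, ← hT, map_mul, map_mul, map_inv]
  · rw [← hι, ← hω, map_mul, map_mul, map_inv]

theorem LieExt.Split.of_equivalent {X Y : LieExt 𝕜 G N} (h : X.Split) (e : X.Equivalent Y) :
    Y.Split := by
  obtain ⟨τ, hτ, hq⟩ := h
  obtain ⟨φ, hφ, -, hφq⟩ := e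
  exact ⟨φ.comp τ, hφ.comp hτ, fun g => (hφq _).trans (hq g)⟩

theorem LieExt.cls_eq_iff [LCLieGroup 𝕜 N] {X Y : LieExt 𝕜 G N} :
    X.cls = Y.cls ↔ X.Equivalent Y :=
  Quotient.eq (r := LieExt.setoid 𝕜 G N)

/-- Changing a section by a map with values in `N` changes its factor system accordingly. -/
theorem LieExt.HasFactorSystem.twist {X : LieExt 𝕜 G N} {T : G → MulAut N} {ω : G × G → N}
    (hX : X.HasFactorSystem T ω) {h : G → N} (hh : h ∈ C1s 𝕜 G N) :
    X.HasFactorSystem (fun g => MulAut.conj (h g) * T g)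
      (fun p => h p.1 * T p.1 (h p.2) * ω p * (h (p.1 * p.2))⁻¹) := by
  obtain ⟨σ, hσ, hq, hT, hω⟩ := hX
  refine ⟨fun g => X.ι (h g) * σ g, ⟨?_, (X.isLieExtension.smooth_ι.comp_near hh.2).mul hσ.2⟩,
    fun g => ?_, LieExt.ι_conj_mul hT h, fun g g' => ?_⟩
  · change X.ι (h 1) * σ 1 = 1
    rw [hh.1, hσ.1, map_one, mul_one]
  · rw [map_mul, X.isLieExtension.q_ι, hq, one_mul]
  · rw [LieExt.mul_of_factor hT hω, map_mul _ _ (h (g * g'))⁻¹, map_inv]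
    group

variable [LCLieGroup 𝕜 N]

/-- The quotient of two sections takes values in the kernel of `q`, and
`IsLieExtension.smoothNear_of_ι_comp` transfers its smoothness near `1` to `N`. -/
theorem LieExt.exists_section_diff {X : LieExt 𝕜 G N} {σ τ : G → X.carrier}
    (hσ : σ ∈ C1s 𝕜 G X.carrier) (hτ : τ ∈ C1s 𝕜 G X.carrier) (hσq : ∀ g, X.q (σ g) = g)
    (hτq : ∀ g, X.q (τ g) = g) : ∃ h ∈ C1s 𝕜 G N, ∀ g, τ g = X.ι (h g) * σ g := by
  have h1 : ∀ g, ∃ n, X.ι n = τ g * (σ g)⁻¹ := fun g =>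
    X.isLieExtension.exists_ι_eq (by rw [map_mul, map_inv, hσq, hτq, mul_inv_cancel])
  choose h hh using h1
  refine ⟨h, ⟨X.isLieExtension.injective ?_, X.isLieExtension.smoothNear_of_ι_comp ?_⟩,
    fun g => ?_⟩
  · rw [hh, hσ.1, hτ.1, map_one, inv_one, mul_one]
  · simp only [hh]
    exact hτ.2.mul hσ.2.inv
  · rw [hh, inv_mul_cancel_right]

/-- The converse of `LieExt.HasFactorSystem.twist`: the twisting map is the quotient of the two
sections. -/
theorem LieExt.HasFactorSystem.exists_twist {X : LieExt 𝕜 G N} {T T' : G → MulAut N}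
    {ω ω' : G × G → N} (hX : X.HasFactorSystem T ω) (hX' : X.HasFactorSystem T' ω') :
    ∃ h ∈ C1s 𝕜 G N, (∀ g, T' g = MulAut.conj (h g) * T g) ∧
      ∀ p, ω' p = h p.1 * T p.1 (h p.2) * ω p * (h (p.1 * p.2))⁻¹ := by
  obtain ⟨σ, hσ, hq, hT, hω⟩ := hX
  obtain ⟨τ, hτ, hq', hT', hω'⟩ := hX'
  obtain ⟨h, hh, hτσ⟩ := LieExt.exists_section_diff hσ hτ hq hq'
  refine ⟨h, hh, fun g => ?_, fun p => X.isLieExtension.injective ?_⟩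
  · ext n
    apply X.isLieExtension.injective
    rw [← hT', hτσ, LieExt.ι_conj_mul hT h]
  · rw [← hω', hτσ, hτσ, hτσ, LieExt.mul_of_factor hT hω, map_mul _ _ (h (p.1 * p.2))⁻¹, map_inv]
    group

/-- Extensions with the same factor system are equivalent. -/
theorem LieExt.HasFactorSystem.equivalent {X Y : LieExt 𝕜 G N} {T : G → MulAut N}
    {ω : G × G → N} (hX : X.HasFactorSystem T ω) (hY : Y.HasFactorSystem T ω) :
    X.Equivalent Y := by
  obtain ⟨σ, hσ, hq, hT, hω⟩ := hX
  obtain ⟨τ, hτ, hq', hT', hω'⟩ := hY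
  -- `ν` is the `N`-coordinate of `x` in its normal form. In these coordinates the product depends
  -- on `(T, ω)` alone, so replacing `σ` by `τ` defines a homomorphism.
  have h1 : ∀ x, ∃ n, X.ι n = x * (σ (X.q x))⁻¹ := fun x =>
    X.isLieExtension.exists_ι_eq (by rw [map_mul, map_inv, hq, mul_inv_cancel])
  choose ν hν using h1
  have hν' : ∀ x, X.ι (ν x) * σ (X.q x) = x := fun x => by rw [hν, inv_mul_cancel_right]
  have hνmul : ∀ x y, ν (x * y) = ν x * T (X.q x) (ν y) * ω (X.q x, X.q y) := fun x y => by
    apply X.isLieExtension.injective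
    apply mul_right_cancel (b := σ (X.q x * X.q y))
    rw [← LieExt.mul_of_factor hT hω, hν', hν', ← map_mul, hν']
  let φ : X.carrier →* Y.carrier := MonoidHom.mk' (fun x => Y.ι (ν x) * τ (X.q x)) fun x y => by
    rw [LieExt.mul_of_factor hT' hω', hνmul, map_mul X.q]
  -- The sections are known to be smooth only near `1`, which suffices because `φ` is a
  -- homomorphism.
  have hφ : SmoothNear 𝕜 φ 1 := by
    have h2 : SmoothNear 𝕜 (fun x => σ (X.q x)) 1 :=
      hσ.2.comp_of_eq (X.isLieExtension.smooth_q.near 1) (map_one _)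
    have h3 : SmoothNear 𝕜 (fun x => τ (X.q x)) 1 :=
      hτ.2.comp_of_eq (X.isLieExtension.smooth_q.near 1) (map_one _)
    have h4 : SmoothNear 𝕜 ν 1 := by
      refine X.isLieExtension.smoothNear_of_ι_comp ?_
      simp only [hν]
      exact (smooth_id.near 1).mul h2.inv
    exact (Y.isLieExtension.smooth_ι.comp_near h4).mul h3
  refine ⟨φ, MonoidHom.smooth_of_smoothNear_one hφ, fun n => ?_, fun x => ?_⟩
  · have : ν (X.ι n) = n := by
      apply X.isLieExtension.injective
      rw [hν, X.isLieExtension.q_ι, hσ.1, inv_one, mul_one]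
    change Y.ι (ν (X.ι n)) * τ (X.q (X.ι n)) = Y.ι n
    rw [this, X.isLieExtension.q_ι, hτ.1, mul_one]
  · change Y.q (Y.ι (ν x) * τ (X.q x)) = X.q x
    rw [map_mul, Y.isLieExtension.q_ι, hq', one_mul]

theorem LieExt.hasFactorSystem_semidirect [LCLieGroup 𝕜 G] {S : G →* MulAut N}
    (hS : Smooth 𝕜 (fun p : G × N => S p.1 p.2)) :
    (LieExt.semidirect S hS).HasFactorSystem S (fun _ => 1) := by
  refine ⟨fun g => ((1 : N), g), ⟨rfl, ((smooth_const 1).prodMk smooth_id).near 1⟩, fun _ => rfl,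
    fun g n => mul_inv_eq_iff_eq_mul.2 ?_, fun g g' => mul_inv_eq_iff_eq_mul.2 ?_⟩
  · refine Prod.ext ?_ ?_
    · change 1 * S g n = S g n * S 1 1
      simp
    · exact (mul_one g).trans (one_mul g).symm
  · refine Prod.ext ?_ ?_
    · change 1 * S g 1 = 1 * S 1 1
      simp
    · exact (one_mul _).symm

theorem LieExt.split_semidirect [LCLieGroup 𝕜 G] {S : G →* MulAut N}
    (hS : Smooth 𝕜 (fun p : G × N => S p.1 p.2)) : (LieExt.semidirect S hS).Split := by
  let σ : G →* SemiProd S := MonoidHom.mk' (fun g => ((1 : N), g)) fun g g' =>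
    Prod.ext (by change 1 = 1 * S g 1; simp) rfl
  exact ⟨σ, (smooth_const 1).prodMk smooth_id, fun _ => rfl⟩

/-- Conjugation by central elements is trivial, so such a twist leaves `S` unchanged. -/
theorem LieExt.HasFactorSystem.mul_d1 {X : LieExt 𝕜 G N} {S : G →* MulAut N} {ω : G × G → N}
    (hX : X.HasFactorSystem S ω) {z : G → Subgroup.center N} (hz : z ∈ C1sZ 𝕜 G N) :
    X.HasFactorSystem S (fun p => ω p * d1 S z p) := by
  have h := hX.twist (h := fun g => (z g : N)) hz
  simp only [MulAut.conj_eq_one_iff.2 (z _).2, one_mul, mul_action_mul_inv_of_central] at h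
  exact h

/-- A twist that preserves `S` conjugates trivially, hence is central. -/
theorem LieExt.HasFactorSystem.exists_d1 {X : LieExt 𝕜 G N} {S : G →* MulAut N}
    {ω ω' : G × G → N} (hX : X.HasFactorSystem S ω) (hX' : X.HasFactorSystem S ω') :
    ∃ z ∈ C1sZ 𝕜 G N, ∀ p, ω' p = ω p * d1 S z p := by
  obtain ⟨h, hh, hT, hω⟩ := hX.exists_twist hX'
  have hc : ∀ g, h g ∈ Subgroup.center N := fun g =>
    MulAut.conj_eq_one_iff.1 (right_eq_mul.1 (hT g))
  exact ⟨fun g => ⟨h g, hc g⟩, hh, fun p =>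
    (hω p).trans (mul_action_mul_inv_of_central (fun g => ⟨h g, hc g⟩) _ p)⟩

/-- The section of a split extension with factor system `(S, ω)` is given by a map `f` for which
`d_S f` is central and equal to `ω⁻¹`. -/
theorem LieExt.HasFactorSystem.exists_of_split {X : LieExt 𝕜 G N} {S : G →* MulAut N}
    {ω : G × G → N} (hX : X.HasFactorSystem S ω) (hs : X.Split) :
    ∃ f ∈ Z1sCentral 𝕜 S, ∀ p, ω p = (dS S f p)⁻¹ := by
  obtain ⟨σ, hσ, hq, hT, hω⟩ := hX
  obtain ⟨τ, hτ, hq'⟩ := hs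
  obtain ⟨f, hf, hτσ⟩ := LieExt.exists_section_diff hσ ⟨map_one τ, hτ.near 1⟩ hq hq'
  have hconj : ∀ g n, τ g * X.ι n * (τ g)⁻¹ = X.ι ((MulAut.conj (f g) * S g) n) := fun g n => by
    rw [hτσ, LieExt.ι_conj_mul hT f]
  -- As `τ` is a homomorphism, so is the conjugation action `C_f S` of `τ(g)` on `N`.
  have hc : ∀ p, dS S f p ∈ Subgroup.center N := fun p => by
    refine (conj_mul_action_iff S f p.1 p.2).1 (MulEquiv.ext fun n => X.isLieExtension.injective ?_)
    rw [← hconj, MulAut.mul_apply, ← hconj, ← hconj, map_mul]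
    group
  refine ⟨f, ⟨hf, hc⟩, fun p => ?_⟩
  -- This is multiplicativity of `τ = ι(f)σ` in normal form.
  have h1 : f p.1 * S p.1 (f p.2) * ω p = f (p.1 * p.2) := by
    apply X.isLieExtension.injective
    apply mul_right_cancel (b := σ (p.1 * p.2))
    rw [← LieExt.mul_of_factor hT hω, ← hτσ, ← hτσ, ← hτσ, map_mul]
  have h2 := Subgroup.mem_center_iff.1 (hc p) (f (p.1 * p.2))
  rw [← dS_mul, ← h2, mul_assoc, mul_eq_left] at h1
  exact (inv_eq_of_mul_eq_one_right h1).symm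

/-- Twisting the section by `h⁻¹` brings the outer action back to `S` itself. -/
theorem mem_ExtKernel_iff {S : G →* MulAut N} (y : LieExtClass 𝕜 G N) :
    y ∈ ExtKernel 𝕜 S ↔ ∃ X : LieExt 𝕜 G N, X.cls = y ∧ ∃ ω, X.HasFactorSystem S ω := by
  constructor
  · rintro ⟨X, hX, T, ω, hTω, h, hh, hT⟩
    have h1 := hTω.twist (h := fun g => (h g)⁻¹) (C1s_inv hh)
    have h2 : (fun g => MulAut.conj (h g)⁻¹ * T g) = S :=
      funext fun g => by rw [hT, map_inv, inv_mul_cancel_left]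
    exact ⟨X, hX, _, h2 ▸ h1⟩
  · rintro ⟨X, hX, ω, hω⟩
    exact ⟨X, hX, S, ω, hω, fun _ => 1, ⟨rfl, (smooth_const 1).near 1⟩, fun g => by simp⟩

variable [LCLieGroup 𝕜 G]

theorem extAct_semidirect_iff {S : G →* MulAut N} (hS : Smooth 𝕜 (fun p : G × N => S p.1 p.2))
    (β : Z2ssZ 𝕜 S) (y : LieExtClass 𝕜 G N) :
    ExtAct S (QuotientGroup.mk β) (LieExt.semidirect S hS).cls y ↔
      ∃ Y : LieExt 𝕜 G N, Y.cls = y ∧ Y.HasFactorSystem S (fun p => (β.1 p : N)) := by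
  constructor
  · rintro ⟨ω, β', X, Y, hβ, hX, hY, hXω, hYω⟩
    obtain ⟨z, hz, hzω⟩ := ((LieExt.hasFactorSystem_semidirect hS).of_equivalent
      (LieExt.cls_eq_iff.1 hX.symm)).exists_d1 hXω
    obtain ⟨z', hz', hzβ⟩ := mk_Z2ssZ_eq_iff.1 hβ
    -- Here `ω = d1 S z`, since `X` is equivalent to the semidirect product, and `β = β' · d1 S z'`.
    -- The correction `z⁻¹z'` therefore carries `ωβ'` to `β`.
    have h := hYω.mul_d1 ((C1sZ 𝕜 G N).mul_mem ((C1sZ 𝕜 G N).inv_mem hz) hz')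
    refine ⟨Y, hY, ?_⟩
    convert h using 2 with p
    rw [hzβ, hzω, one_mul]
    have h1 := Subgroup.mem_center_iff.1 (d1 S z p).2 (β'.1 p)
    rw [← h1, map_mul, map_inv]
    change (β'.1 p : N) * d1 S z' p = β'.1 p * d1 S z p * ((d1 S z p : N)⁻¹ * d1 S z' p)
    simp [mul_assoc]
  · rintro ⟨Y, hY, hYβ⟩
    exact ⟨fun _ => 1, β, _, Y, rfl, rfl, hY, LieExt.hasFactorSystem_semidirect hS,
      by simpa only [one_mul] using hYβ⟩

/-- `f` is smooth only near `1`, but each automorphism `C_{f(g)} S(g)` is smooth, so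
`smooth_action_of_smoothNear_one` applies. -/
theorem smooth_twistedAction {S : G →* MulAut N} (hS : Smooth 𝕜 (fun p : G × N => S p.1 p.2))
    {f : G → N} (hf : f ∈ Z1sCentral 𝕜 S) :
    Smooth 𝕜 (fun p : G × N => twistedAction S f hf.2 p.1 p.2) := by
  refine smooth_action_of_smoothNear_one (fun g => ?_) fun x => ?_
  · exact ((smooth_const (f g)).mul (smooth_translate hS g)).mul (smooth_const (f g)⁻¹)
  · have h : SmoothNear 𝕜 (fun p : G × N => f p.1) (1, x) :=
      hf.1.2.comp_of_eq (smooth_fst.near _) rfl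
    exact (h.mul (hS.near _)).mul h.inv

/-- If `d_S f` is central, then the semidirect product for the twisted action has the factor system
`(S, (d_S f)⁻¹)`. -/
theorem LieExt.hasFactorSystem_twisted {S : G →* MulAut N}
    (hS : Smooth 𝕜 (fun p : G × N => S p.1 p.2)) {f : G → N} (hf : f ∈ Z1sCentral 𝕜 S) :
    (LieExt.semidirect _ (smooth_twistedAction hS hf)).HasFactorSystem S
      (fun p => (dS S f p)⁻¹) := by
  -- The section `g ↦ (f(g)⁻¹, g)` cancels the conjugation `C_f`, and its defect is computed from
  -- the trivial factor system.
  have h := (LieExt.hasFactorSystem_semidirect (smooth_twistedAction hS hf)).twist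
    (h := fun g => (f g)⁻¹) (C1s_inv hf.1)
  convert h using 2 with g p
  · change S g = MulAut.conj (f g)⁻¹ * (MulAut.conj (f g) * S g)
    rw [map_inv, inv_mul_cancel_left]
  · change (dS S f p)⁻¹ = (f p.1)⁻¹ * (f p.1 * S p.1 (f p.2)⁻¹ * (f p.1)⁻¹) * 1 *
      (f (p.1 * p.2))⁻¹⁻¹
    have h1 := Subgroup.mem_center_iff.1 ((Subgroup.center N).inv_mem (hf.2 p)) (f (p.1 * p.2))⁻¹
    rw [eq_mul_inv_iff_mul_eq, ← h1, ← mul_inv_rev]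
    have h2 := dS_mul S f p.1 p.2
    rw [show dS S f p * f (p.1 * p.2) = f p.1 * S p.1 (f p.2) from h2]
    simp [mul_assoc]

/-- Necessity is `LieExt.HasFactorSystem.exists_of_split`. For sufficiency, the twisted semidirect
product splits and has the same factor system, hence the same class. -/
theorem mem_ExtKernelSplit_iff {S : G →* MulAut N} (hS : Smooth 𝕜 (fun p : G × N => S p.1 p.2))
    (y : LieExtClass 𝕜 G N) :
    y ∈ ExtKernelSplit 𝕜 S ↔ ∃ f ∈ Z1sCentral 𝕜 S, ∃ X : LieExt 𝕜 G N, X.cls = y ∧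
      X.HasFactorSystem S (fun p => (dS S f p)⁻¹) := by
  constructor
  · rintro ⟨h, X, hX, hs⟩
    obtain ⟨X', hX', ω, hω⟩ := (mem_ExtKernel_iff y).1 h
    obtain ⟨f, hf, hfω⟩ := hω.exists_of_split
      (hs.of_equivalent (LieExt.cls_eq_iff.1 (hX.trans hX'.symm)))
    exact ⟨f, hf, X', hX', by rwa [← funext hfω]⟩
  · rintro ⟨f, hf, X, hX, hω⟩
    refine ⟨(mem_ExtKernel_iff y).2 ⟨X, hX, _, hω⟩, _, ?_,
      LieExt.split_semidirect (smooth_twistedAction hS hf)⟩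
    rw [← hX, LieExt.cls_eq_iff]
    exact (LieExt.hasFactorSystem_twisted hS hf).equivalent hω

end FactorSystems

/-! ### Assembly of the exact sequence and the split classes -/

theorem mainTheorem9 {𝕜 : Type*} [RCLike 𝕜]
    {G : Type u} [TopologicalSpace G] [Group G] [LCManifold 𝕜 G] [LCLieGroup 𝕜 G]
    {N : Type v} [TopologicalSpace N] [Group N] [LCManifold 𝕜 N] [LCLieGroup 𝕜 N]
    [LCManifold 𝕜 (Subgroup.center N)] [LCLieGroup 𝕜 (Subgroup.center N)]
    [LCManifold 𝕜 (N ⧸ Subgroup.center N)]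
    (hZ : IsSplitLieSubgroup 𝕜 (Subgroup.center N))
    (S : G →* MulAut N) (hS : Smooth 𝕜 (fun p : G × N => S p.1 p.2)) :
    -- `N_ad = N / Z(N)` is a Lie group on which `G` acts smoothly
    LCLieGroup 𝕜 (N ⧸ Subgroup.center N) ∧
    Smooth 𝕜 (fun p : G × (N ⧸ Subgroup.center N) => adAut N (S p.1) p.2) ∧
    ∃ (i₀ : fixedPts ((centerAut N).comp S) →* fixedPts S)
      (q₀ : fixedPts S →* fixedPts ((adAut N).comp S))
      (δ₀ : fixedPts ((adAut N).comp S) →* H1sZ 𝕜 S)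
      (i₁ : H1sZ 𝕜 S → H1s 𝕜 S)
      (q₁ : H1s 𝕜 S → H1s 𝕜 ((adAut N).comp S))
      (δ : H1s 𝕜 ((adAut N).comp S) → H2ssZ 𝕜 S),
      -- description of the maps
      (∀ z, (i₀ z : N) = ((z : Subgroup.center N) : N)) ∧
      (∀ n, (q₀ n : N ⧸ Subgroup.center N) = QuotientGroup.mk (n : N)) ∧
      (∀ (x : fixedPts ((adAut N).comp S)) (n : N), QuotientGroup.mk n = x.1 →
        ∃ c : Z1sZ 𝕜 S, (∀ g, (c.1 g : N) = n⁻¹ * S g n) ∧ δ₀ x = QuotientGroup.mk c) ∧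
      (∀ c : Z1sZ 𝕜 S, ∃ f : Z1s 𝕜 S, (∀ g, f.1 g = (c.1 g : N)) ∧
        i₁ (QuotientGroup.mk c) = H1s.mk 𝕜 S f) ∧
      (∀ f : Z1s 𝕜 S, ∃ f' : Z1s 𝕜 ((adAut N).comp S),
        (∀ g, f'.1 g = QuotientGroup.mk (f.1 g)) ∧
        q₁ (H1s.mk 𝕜 S f) = H1s.mk 𝕜 ((adAut N).comp S) f') ∧
      (∀ f : Z1s 𝕜 ((adAut N).comp S),
        (∃ fh ∈ Z1sCentral 𝕜 S, ∀ g, QuotientGroup.mk (fh g) = f.1 g) ∧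
        ∀ fh ∈ Z1sCentral 𝕜 S, (∀ g, QuotientGroup.mk (fh g) = f.1 g) →
          ∃ c : Z2ssZ 𝕜 S, (∀ p, (c.1 p : N) = dS S fh p) ∧
            δ (H1s.mk 𝕜 ((adAut N).comp S) f) = QuotientGroup.mk c) ∧
      -- exactness
      Function.Injective i₀ ∧
      q₀.ker = i₀.range ∧
      δ₀.ker = q₀.range ∧
      (∀ c, i₁ c = H1s.base 𝕜 S ↔ c ∈ δ₀.range) ∧
      (∀ x, q₁ x = H1s.base 𝕜 ((adAut N).comp S) ↔ x ∈ Set.range i₁) ∧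
      (∀ y, δ y = 1 ↔ y ∈ Set.range q₁) ∧
      -- the split extensions: `Ext(G, N)_{[S], split} = (- im δ).[N ⋊_S G]`
      (∀ c ∈ Set.range δ, ∃! y, ExtAct S c⁻¹ (LieExt.semidirect S hS).cls y) ∧
      ExtKernelSplit 𝕜 S =
        {y | ∃ c ∈ Set.range δ, ExtAct S c⁻¹ (LieExt.semidirect S hS).cls y} := by
  -- The inverse class is represented by the pointwise inverse cocycle, whose values are `(dS S f
  -- p)⁻¹`.
  have key : ∀ f (hf : f ∈ Z1sCentral 𝕜 S) y,
      ExtAct S (QuotientGroup.mk (centralCocycle hS f hf))⁻¹ (LieExt.semidirect S hS).cls y ↔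
        ∃ Y : LieExt 𝕜 G N, Y.cls = y ∧ Y.HasFactorSystem S (fun p => (dS S f p)⁻¹) :=
    fun f hf y => extAct_semidirect_iff hS (centralCocycle hS f hf)⁻¹ y
  refine ⟨IsLieExtension.lcLieGroup_base hZ, smooth_adAut hZ hS, fixedIncl S, fixedProj S,
    connectingHom hS, H1sZ.toH1s, H1s.toAd hZ, connectingMap hZ hS, fun _ => rfl, fun _ => rfl,
    fun x n hn => ?_, fun c => ⟨⟨_, mem_Z1sZ_iff.1 c.2⟩, fun _ => rfl, rfl⟩,
    fun f => ⟨adZ1s hZ f, fun _ => rfl, rfl⟩, fun f => ⟨exists_lift_mem_Z1sCentral hZ f,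
      fun fh hfh h => ⟨centralCocycle hS fh hfh, fun _ => rfl, connectingMap_mk hZ hS f hfh h⟩⟩,
    fun z z' h => Subtype.ext (Subtype.ext (congrArg (fun n : fixedPts S => (n : N)) h)),
    fixedProj_ker,
    connectingHom_ker hS, H1sZ.toH1s_eq_base_iff hS, H1s.toAd_eq_base_iff hZ hS,
    connectingMap_eq_one_iff hZ hS, ?_, ?_⟩
  · have hn' := mem_fixedPts_ad_iff.1 (hn.symm ▸ x.2 : QuotientGroup.mk n ∈ _)
    exact ⟨fixedCocycle hS n hn', fun _ => rfl, connectingHom_apply hS x hn hn'⟩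
  · rintro _ ⟨y, rfl⟩
    obtain ⟨f, rfl⟩ := Quotient.exists_rep y
    obtain ⟨fh, hfh, h⟩ := exists_lift_mem_Z1sCentral hZ f
    have hδ : connectingMap hZ hS (Quotient.mk _ f) = _ := connectingMap_mk hZ hS f hfh h
    rw [hδ]
    -- The twisted semidirect product shows that the action is defined here; uniqueness holds since
    -- equal factor systems give equivalent extensions.
    have hY := LieExt.hasFactorSystem_twisted hS hfh
    refine ⟨_, (key fh hfh _).2 ⟨_, rfl, hY⟩, fun y hy => ?_⟩
    obtain ⟨Y, rfl, hYf⟩ := (key fh hfh y).1 hy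
    exact LieExt.cls_eq_iff.2 (hYf.equivalent hY)
  · ext y
    rw [mem_ExtKernelSplit_iff hS]
    constructor
    · rintro ⟨f, hf, X, hX, hXf⟩
      -- Any `f` with central differential is a lift of its own image in `N_ad`.
      refine ⟨_, ⟨H1s.mk 𝕜 _ (adCocycle hZ f hf), rfl⟩, ?_⟩
      rw [connectingMap_mk hZ hS (adCocycle hZ f hf) hf fun _ => rfl]
      exact (key f hf y).2 ⟨X, hX, hXf⟩
    · rintro ⟨_, ⟨x, rfl⟩, hy⟩
      obtain ⟨f, rfl⟩ := Quotient.exists_rep x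
      obtain ⟨fh, hfh, h⟩ := exists_lift_mem_Z1sCentral hZ f
      have hδ : connectingMap hZ hS (Quotient.mk _ f) = _ := connectingMap_mk hZ hS f hfh h
      rw [hδ] at hy
      exact ⟨fh, hfh, (key fh hfh y).1 hy⟩
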